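/- Let $n^\omega$ be the space of infinite sequences over $\{0,\dots,n-1\}$, let $\llbracket\sigma\rrbracket$ be the set of sequences extending the finite string $\sigma$, and let $\lambda$ be the uniform (Lebesgue) measure on $n^\omega$, $\lambda(\llbracket\sigma\rrbracket)=n^{-|\sigma|}$. A sequence $x\in n^\omega$ is Martin-Löf random if $x\notin\bigcap_i U_i$ for every uniformly $\Sigma^0_1$ sequence $(U_i)_{i\in\omega}$ of subsets of $n^\omega$ with $\lambda(U_i)\le 2^{-i}$ for all $i$. Let $\sigma_0=\epsilon,\sigma_1=0,\sigma_2=1,\sigma_3=00,\dots$ be the length-lexicographic enumeration of the finite binary strings. *Random continuous functions.* For $x\in 3^\omega$ label each nonempty string $\sigma_i$ ($i\ge1$) by $\ell_x(\sigma_i)=x(i-1)\in\{0,1,2\}$. The partial continuous function $F_x$ from $2^\omega$ to $2^\omega$ sends $y$ to the sequence obtained by deleting all $2$'s from $\ell_x(y\restriction1),\ell_x(y\restriction2),\dots$, and is undefined at $y$ if only finitely many digits remain. A random continuous function is a function $F=F_x$ with $x\in3^\omega$ Martin-Löf random. It induces the measure $\lambda_F(B)=\lambda(F^{-1}(B))$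 on the Borel sets $B\subseteq2^\omega$. *Random measures (in Culver's sense).* For $x\in2^\omega$ let $x_n=\sum_{k}x(\langle n,k\rangle)2^{-k-1}\in[0,1]$ be the real whose binary expansion is the $n$-th column of $x$, where $\langle\cdot,\cdot\rangle$ is a fixed computable bijection $\omega^2\to\omega$, and let $\mu_x$ be the unique Borel probability measure on $2^\omega$ with $\mu_x(\llbracket\sigma_n0\rrbracket)=x_n\cdot\mu_x(\llbracket\sigma_n\rrbracket)$ for all $n$. A random measure is a measure $\mu_x$ with $x\in2^\omega$ Martin-Löf random. **Theorem.** No measure induced by a random continuous function is a random measure: for every random continuous function $F$, the measure $\lambda_F$ is not a random measure. -/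

import Mathlib

open MeasureTheory Set
open scoped ENNReal

namespace AlgRandom

/-- The space `n^ω` of infinite sequences over the alphabet `{0, …, n-1}`
(with the product topology and its Borel σ-algebra). -/
abbrev Seq (n : ℕ) : Type := ℕ → Fin n

/-- The basic clopen set of all sequences extending the finite string `σ`. -/
def cyl {n : ℕ} (σ : List (Fin n)) : Set (Seq n) :=
  {x | ∀ i : Fin σ.length, x i = σ.get i}

/-- The initial segment of `x` of length `k`. -/
def restr {n : ℕ} (x : Seq n) (k : ℕ) : List (Fin n) := List.ofFn fun i : Fin k => x i

/-- The Lebesgue (uniform product) measure on `n^ω`. -/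
noncomputable def lebesgue (n : ℕ) [NeZero n] : Measure (Seq n) :=
  Measure.infinitePi fun _ => (PMF.uniformOfFintype (Fin n)).toMeasure

/-- A Martin-Löf test with respect to `μ`: a uniformly `Σ⁰₁` sequence of sets `U i`
(given by one r.e. set of pairs `(i, σ)`) with `μ (U i) ≤ 2⁻ⁱ`. -/
def IsMLTest {n : ℕ} (μ : Measure (Seq n)) (U : ℕ → Set (Seq n)) : Prop :=
  (∃ W : ℕ × List (Fin n) → Prop, REPred W ∧
    ∀ i, U i = {x | ∃ σ, W (i, σ) ∧ x ∈ cyl σ}) ∧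
  ∀ i, μ (U i) ≤ 2⁻¹ ^ i

/-- `x` is Martin-Löf random with respect to `μ`. -/
def IsMLRandom {n : ℕ} (μ : Measure (Seq n)) (x : Seq n) : Prop :=
  ∀ U : ℕ → Set (Seq n), IsMLTest μ U → x ∉ ⋂ i, U i

/-- The position of a binary string in the length-lexicographic enumeration
`σ₀ = ε, σ₁ = 0, σ₂ = 1, σ₃ = 00, σ₄ = 01, …`. -/
def idx (σ : List (Fin 2)) : ℕ := σ.foldl (fun k b => 2 * k + (b : ℕ) + 1) 0

/-! ### Random continuous functions -/

/-- The label of a nonempty string: `σᵢ` (for `i ≥ 1`) is labeled by `x (i - 1)`. -/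
def label (x : Seq 3) (σ : List (Fin 2)) : Fin 3 := x (idx σ - 1)

/-- The labels met when following `y` through the labeled tree:
the labels of the initial segments of `y` of lengths `1, 2, 3, …`. -/
def labelsAlong (x : Seq 3) (y : Seq 2) : Seq 3 := fun k => label x (restr y (k + 1))

/-- Remove the `2`'s from a sequence over `{0,1,2}`; defined when infinitely many
digits different from `2` occur. -/
noncomputable def removeTwos : Seq 3 →. Seq 2 := fun s =>
  ⟨{k | s k ≠ 2}.Infinite, fun _ j => if s (Nat.nth (fun k => s k ≠ 2) j) = 1 then 1 else 0⟩

/-- The partial function `F_x` on `2^ω` coded by `x ∈ 3^ω`. -/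
noncomputable def codedFun (x : Seq 3) : Seq 2 →. Seq 2 := fun y => removeTwos (labelsAlong x y)

/-- `F` is a random continuous function. -/
def IsRandomContinuousFunction (F : Seq 2 →. Seq 2) : Prop :=
  ∃ x : Seq 3, IsMLRandom (lebesgue 3) x ∧ F = codedFun x

/-- The measure `λ_F = λ ∘ F⁻¹` induced by a partial function `F` on `2^ω`
(see `inducedMeasure_codedFun_apply`). -/
noncomputable def inducedMeasure (F : Seq 2 →. Seq 2) : Measure (Seq 2) :=
  ((lebesgue 2).comap (Subtype.val : F.Dom → Seq 2)).map fun y => F.fn y.1 y.2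

/-! ### Random measures -/

/-- The real number in `[0,1]` whose binary expansion is the `n`-th column of `x`. -/
noncomputable def columnReal (x : Seq 2) (n : ℕ) : ℝ :=
  ∑' k : ℕ, ((x (Nat.pair n k) : ℕ) : ℝ) / 2 ^ (k + 1)

/-- `μ` is the measure `μ_x` on `2^ω` coded by `x ∈ 2^ω`: it has total mass one and gives `σₙ0` the
fraction `xₙ` of the mass of `σₙ`. (There is exactly one, see `existsUnique_isCodedMeasure`.) -/
def IsCodedMeasure (x : Seq 2) (μ : Measure (Seq 2)) : Prop :=
  μ (cyl []) = 1 ∧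
  ∀ σ : List (Fin 2), μ (cyl (σ ++ [0])) = ENNReal.ofReal (columnReal x (idx σ)) * μ (cyl σ)

/-- `μ` is an (algorithmically) random measure on `2^ω`. -/
def IsRandomMeasure (μ : Measure (Seq 2)) : Prop :=
  ∃ x : Seq 2, IsMLRandom (lebesgue 2) x ∧ IsCodedMeasure x μ

/-! ### The induced measure is the pushforward, and coded measures exist uniquely -/

theorem continuous_label (x : Seq 3) (k : ℕ) : Continuous fun y => labelsAlong x y k := by
  have : (fun y : Seq 2 => labelsAlong x y k) =
      (fun v : Fin (k + 1) → Fin 2 => label x (List.ofFn v)) ∘ fun y i => y i := rfl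
  rw [this]
  exact continuous_of_discreteTopology.comp (by fun_prop)

theorem measurableSet_dom (x : Seq 3) : MeasurableSet (codedFun x).Dom := by
  have h : (codedFun x).Dom = ⋂ N : ℕ, ⋃ k : ℕ, ⋃ _ : N < k, {y | labelsAlong x y k ≠ 2} := by
    ext y
    simp only [mem_iInter, mem_iUnion, mem_ofPred_eq]
    change {k | labelsAlong x y k ≠ 2}.Infinite ↔ _
    rw [Set.infinite_iff_exists_gt]
    simp only [mem_ofPred_eq]
    exact forall_congr' fun N => ⟨fun ⟨k, a, b⟩ => ⟨k, b, a⟩, fun ⟨k, a, b⟩ => ⟨k, b, a⟩⟩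
  rw [h]
  refine MeasurableSet.iInter fun N => MeasurableSet.iUnion fun k => MeasurableSet.iUnion fun _ => ?_
  exact ((isClosed_singleton (x := (2 : Fin 3))).isOpen_compl.preimage
    (continuous_label x k)).measurableSet

theorem continuous_codedFun (x : Seq 3) :
    Continuous fun y : (codedFun x).Dom => (codedFun x).fn y.1 y.2 := by
  refine continuous_pi fun j => continuous_iff_continuousAt.2 fun y => ?_
  have hy : {k | labelsAlong x y.1 k ≠ 2}.Infinite := y.2
  set K := Nat.nth (fun k => labelsAlong x y.1 k ≠ 2) j with hK
  have hev : ∀ᶠ y' : (codedFun x).Dom in nhds y,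
      ∀ k ∈ Finset.range (K + 1), labelsAlong x y'.1 k = labelsAlong x y.1 k := by
    refine (Filter.eventually_all_finset _).2 fun k _ => ?_
    have := ((continuous_label x k).comp continuous_subtype_val).continuousAt (x := y)
    exact this.eventually (p := fun c => c = labelsAlong x y.1 k)
      (by rw [nhds_discrete]; rfl)
  refine ContinuousAt.congr (f := fun _ => (codedFun x).fn y.1 y.2 j) continuousAt_const ?_
  filter_upwards [hev] with y' h'
  have hKp : labelsAlong x y.1 K ≠ 2 := Nat.nth_mem_of_infinite hy j
  have hcnt : Nat.count (fun k => labelsAlong x y.1 k ≠ 2) K = j :=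
    Nat.count_nth_of_infinite hy j
  have hcnt' : Nat.count (fun k => labelsAlong x y'.1 k ≠ 2) K = j := by
    rw [← hcnt, Nat.count_eq_card_filter_range, Nat.count_eq_card_filter_range]
    congr 1
    refine Finset.filter_congr fun k hk => ?_
    rw [h' k (Finset.mem_range.2 (by have := Finset.mem_range.1 hk; omega))]
  have hKK := h' K (Finset.mem_range.2 (by omega))
  have hn : Nat.nth (fun k => labelsAlong x y'.1 k ≠ 2) j = K := by
    rw [← hcnt']
    exact Nat.nth_count (p := fun k => labelsAlong x y'.1 k ≠ 2) (by rw [hKK]; exact hKp)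
  change (if labelsAlong x y.1 (Nat.nth (fun k => labelsAlong x y.1 k ≠ 2) j) = 1 then (1 : Fin 2)
    else 0) = if labelsAlong x y'.1 (Nat.nth (fun k => labelsAlong x y'.1 k ≠ 2) j) = 1 then 1 else 0
  rw [hn, hKK, ← hK]

theorem inducedMeasure_codedFun_apply (x : Seq 3) {B : Set (Seq 2)} (hB : MeasurableSet B) :
    inducedMeasure (codedFun x) B = lebesgue 2 ((codedFun x).preimage B) := by
  have hm := (continuous_codedFun x).measurable
  rw [inducedMeasure, Measure.map_apply hm hB,
    (MeasurableEmbedding.subtype_coe (measurableSet_dom x)).comap_apply]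
  congr 1
  ext y
  constructor
  · rintro ⟨⟨y, hy⟩, h, rfl⟩
    exact ⟨_, h, hy, rfl⟩
  · rintro ⟨z, hz, hy, rfl⟩
    exact ⟨⟨y, hy⟩, hz, rfl⟩

theorem cyl_append {n : ℕ} (σ : List (Fin n)) (b : Fin n) :
    cyl (σ ++ [b]) = cyl σ ∩ {x | x σ.length = b} := by
  ext x
  simp only [cyl, mem_ofPred_eq, mem_inter_iff, List.get_eq_getElem]
  constructor
  · intro h
    refine ⟨fun i => ?_, ?_⟩
    · have := h ⟨i, by simp only [List.length_append, List.length_singleton]; omega⟩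
      simpa using this
    · have := h ⟨σ.length, by simp⟩
      simpa using this
  · rintro ⟨h1, h2⟩ ⟨i, hi⟩
    simp only [List.length_append, List.length_singleton] at hi
    rcases Nat.lt_succ_iff_lt_or_eq.1 hi with h | rfl
    · simpa [List.getElem_append, h] using h1 ⟨i, h⟩
    · simpa using h2

theorem measurableSet_cyl {n : ℕ} (σ : List (Fin n)) : MeasurableSet (cyl σ) := by
  have : cyl σ = ⋂ i : Fin σ.length, (fun x : Seq n => x i) ⁻¹' {σ.get i} := by
    ext x; simp [cyl]
  rw [this]
  exact MeasurableSet.iInter fun i => measurable_pi_apply _ (measurableSet_singleton _)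

theorem lebesgue_cyl {n : ℕ} [NeZero n] (σ : List (Fin n)) :
    lebesgue n (cyl σ) = (n : ℝ≥0∞)⁻¹ ^ σ.length := by
  rcases σ.eq_nil_or_concat with rfl | ⟨τ, b, hσ⟩
  · have : (cyl ([] : List (Fin n))) = univ := by ext x; simp [cyl]
    rw [this, lebesgue]; simp
  have : cyl σ = Set.pi (Finset.range σ.length : Finset ℕ) fun i => {σ.getD i b} := by
    ext x
    simp only [cyl, mem_ofPred_eq, Set.mem_pi, Finset.coe_range, mem_Iio, mem_singleton_iff,
      List.get_eq_getElem]
    exact ⟨fun h i hi => by rw [List.getD_eq_getElem _ _ hi]; exact h ⟨i, hi⟩,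
      fun h i => by rw [h i i.2, List.getD_eq_getElem _ _ i.2]⟩
  rw [this, lebesgue, Measure.infinitePi_pi _ (fun i _ => measurableSet_singleton _)]
  simp

theorem idx_append (σ : List (Fin 2)) (b : Fin 2) : idx (σ ++ [b]) = 2 * idx σ + b + 1 := by
  simp [idx]

/-- Every position is taken by exactly one string. -/
theorem idx_bijective : Function.Bijective idx := by
  constructor
  · intro σ
    induction σ using List.reverseRecOn with
    | nil =>
      intro τ h
      rcases τ.eq_nil_or_concat with rfl | ⟨τ, c, rfl⟩
      · rfl
      · rw [List.concat_eq_append, idx_append] at h; simp [idx] at h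
    | append_singleton σ b ih =>
      intro τ h
      rcases τ.eq_nil_or_concat with rfl | ⟨τ, c, rfl⟩
      · rw [idx_append] at h; simp [idx] at h
      · rw [List.concat_eq_append, idx_append, idx_append] at h
        have hb := b.2
        have hc := c.2
        rw [List.concat_eq_append, ih (a₂ := τ) (by omega), show b = c from Fin.ext (by omega)]
  · intro n
    induction n using Nat.strong_induction_on with
    | _ n ih =>
      rcases n with _ | n
      · exact ⟨[], rfl⟩
      · obtain ⟨σ, hσ⟩ := ih (n / 2) (by omega)
        refine ⟨σ ++ [⟨n % 2, by omega⟩], ?_⟩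
        rw [idx_append, hσ]
        simp only
        omega

theorem columnReal_mem (x : Seq 2) (n : ℕ) : columnReal x n ∈ Icc (0 : ℝ) 1 := by
  have : columnReal x n = Real.ofDigits fun k => x (Nat.pair n k) := by
    simp only [columnReal, Real.ofDigits, Real.ofDigitsTerm, div_eq_mul_inv]
    norm_num
  rw [this]
  exact ⟨Real.ofDigits_nonneg _, Real.ofDigits_le_one _⟩

theorem isPiSystem_cyl : IsPiSystem (range (cyl : List (Fin 2) → Set (Seq 2))) := by
  have key : ∀ σ τ : List (Fin 2), σ.length ≤ τ.length → (cyl σ ∩ cyl τ).Nonempty →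
      cyl σ ∩ cyl τ = cyl τ := by
    rintro σ τ h ⟨x, hσ, hτ⟩
    refine inter_eq_right.2 fun y hy i => ?_
    have hi : i.1 < τ.length := i.2.trans_le h
    rw [← hσ i, hy ⟨i, hi⟩, hτ ⟨i, hi⟩]
  rintro _ ⟨σ, rfl⟩ _ ⟨τ, rfl⟩ hne
  rcases le_total σ.length τ.length with h | h
  · exact ⟨τ, (key σ τ h hne).symm⟩
  · rw [inter_comm] at hne ⊢
    exact ⟨σ, (key τ σ h hne).symm⟩

theorem mem_cyl_restr {n : ℕ} (x : Seq n) (k : ℕ) : x ∈ cyl (restr x k) := by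
  have : ∀ j (h : j < (restr x k).length), (restr x k)[j] = x j := by intros; simp [restr]
  exact fun i => (this i i.2).symm

theorem generateFrom_cyl :
    (inferInstance : MeasurableSpace (Seq 2)) = .generateFrom (range cyl) := by
  refine le_antisymm ?_ (MeasurableSpace.generateFrom_le ?_)
  · refine iSup_le fun k => ?_
    rintro _ ⟨s, -, rfl⟩
    have : (fun x : Seq 2 => x k) ⁻¹' s =
        ⋃ σ ∈ {σ : List (Fin 2) | cyl σ ⊆ (fun x : Seq 2 => x k) ⁻¹' s}, cyl σ := by
      ext x
      simp only [mem_iUnion]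
      constructor
      · intro hx
        refine ⟨restr x (k + 1), fun y hy => ?_, mem_cyl_restr x _⟩
        have := hy ⟨k, by simp [restr]⟩
        simp only [restr, List.get_eq_getElem, List.getElem_ofFn] at this
        simpa [this] using hx
      · rintro ⟨σ, h, hx⟩
        exact h hx
    rw [this]
    exact MeasurableSet.biUnion (to_countable _) fun σ _ =>
      MeasurableSpace.measurableSet_generateFrom ⟨σ, rfl⟩
  · rintro _ ⟨σ, rfl⟩
    exact measurableSet_cyl σ

theorem cyl_nil {n : ℕ} : cyl ([] : List (Fin n)) = univ := by ext x; simp [cyl]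

theorem isCodedMeasure_unique {x : Seq 2} {μ ν : Measure (Seq 2)} (hμ : IsCodedMeasure x μ)
    (hν : IsCodedMeasure x ν) : μ = ν := by
  have : IsProbabilityMeasure μ := ⟨by rw [← cyl_nil]; exact hμ.1⟩
  have : IsProbabilityMeasure ν := ⟨by rw [← cyl_nil]; exact hν.1⟩
  have hcyl : ∀ σ : List (Fin 2), μ (cyl σ) = ν (cyl σ) := by
    intro σ
    induction σ using List.reverseRecOn with
    | nil => rw [hμ.1, hν.1]
    | append_singleton σ b ih =>
      have h0 : μ (cyl (σ ++ [0])) = ν (cyl (σ ++ [0])) := by rw [hμ.2, hν.2, ih]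
      have hd : cyl (σ ++ [1]) = cyl σ \ cyl (σ ++ [0]) := by
        ext x
        simp only [cyl_append, mem_inter_iff, mem_sdiff, mem_ofPred_eq]
        have : x σ.length = 1 ↔ ¬ x σ.length = 0 := by generalize x σ.length = c; decide +revert
        tauto
      have hs : cyl (σ ++ [0]) ⊆ cyl σ := by rw [cyl_append]; exact inter_subset_left
      fin_cases b
      · exact h0
      · change μ (cyl (σ ++ [1])) = ν (cyl (σ ++ [1]))
        rw [hd, measure_sdiff hs (measurableSet_cyl _).nullMeasurableSet (measure_ne_top _ _),
          measure_sdiff hs (measurableSet_cyl _).nullMeasurableSet (measure_ne_top _ _), ih, h0]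
  refine ext_of_generate_finite _ generateFrom_cyl isPiSystem_cyl ?_ (by simp)
  rintro _ ⟨σ, rfl⟩
  exact hcyl σ

/-- Follow the directions `ω` from the root: the node reached after `k` steps. -/
def node (ω : List (Fin 2) → Fin 2) : ℕ → List (Fin 2)
  | 0 => []
  | k + 1 => node ω k ++ [ω (node ω k)]

theorem node_eq {ω : List (Fin 2) → Fin 2} (σ : List (Fin 2))
    (h : (fun k => ω (node ω k)) ∈ cyl σ) : node ω σ.length = σ := by
  induction σ using List.reverseRecOn with
  | nil => rfl
  | append_singleton σ b ih =>
    rw [cyl_append] at h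
    have h2 : ω (node ω σ.length) = b := h.2
    rw [ih h.1] at h2
    simp [node, ih h.1, h2]

theorem measurableSet_node (k : ℕ) (σ : List (Fin 2)) : MeasurableSet {ω | node ω k = σ} := by
  induction k generalizing σ with
  | zero => exact MeasurableSet.const ([] = σ)
  | succ k ih =>
    have : {ω | node ω (k + 1) = σ} =
        ⋃ τ, {ω | node ω k = τ} ∩ (fun ω => ω τ) ⁻¹' {b | τ ++ [b] = σ} := by
      ext ω; simp [node]
    rw [this]
    exact MeasurableSet.iUnion fun τ => (ih τ).inter (measurable_pi_apply τ (.of_discrete))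

theorem measurable_path :
    Measurable fun (ω : List (Fin 2) → Fin 2) => ((fun k => ω (node ω k)) : Seq 2) := by
  refine measurable_pi_lambda _ fun k s _ => ?_
  have : (fun ω : List (Fin 2) → Fin 2 => ω (node ω k)) ⁻¹' s =
      ⋃ τ, {ω | node ω k = τ} ∩ (fun ω => ω τ) ⁻¹' s := by
    ext ω; simp
  rw [this]
  exact MeasurableSet.iUnion fun τ =>
    (measurableSet_node k τ).inter (measurable_pi_apply τ (.of_discrete))

/-- The proper initial segments of a string. -/
def properPrefixes (σ : List (Fin 2)) : Finset (List (Fin 2)) :=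
  (Finset.range σ.length).image fun i => σ.take i

theorem length_of_mem_properPrefixes {σ τ : List (Fin 2)} (h : τ ∈ properPrefixes σ) :
    τ.length < σ.length := by
  obtain ⟨i, hi, rfl⟩ := Finset.mem_image.1 h
  have := Finset.mem_range.1 hi
  simp; omega

theorem properPrefixes_append (σ : List (Fin 2)) (b : Fin 2) :
    properPrefixes (σ ++ [b]) = insert σ (properPrefixes σ) := by
  simp only [properPrefixes, List.length_append, List.length_singleton, Finset.range_add_one,
    Finset.image_insert]
  congr 1
  · simp
  · refine Finset.image_congr fun i hi => ?_
    have : i < σ.length := by simpa using hi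
    simp [List.take_append_of_le_length this.le]

theorem path_mem_cyl (ω : List (Fin 2) → Fin 2) (σ : List (Fin 2)) :
    (fun k => ω (node ω k)) ∈ cyl σ ↔ ∀ τ ∈ properPrefixes σ, ω τ = σ.getD τ.length 0 := by
  induction σ using List.reverseRecOn with
  | nil => simp [cyl, properPrefixes]
  | append_singleton σ b ih =>
    rw [cyl_append, properPrefixes_append]
    simp only [mem_inter_iff, mem_ofPred_eq, Finset.forall_mem_insert]
    have e : (∀ τ ∈ properPrefixes σ, ω τ = (σ ++ [b]).getD τ.length 0) ↔
        ∀ τ ∈ properPrefixes σ, ω τ = σ.getD τ.length 0 :=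
      forall₂_congr fun τ hτ => by
        rw [List.getD_append _ _ _ _ (length_of_mem_properPrefixes hτ)]
    rw [e, ← ih, and_comm]
    refine and_congr_left fun h => ?_
    rw [node_eq σ h]
    simp

theorem existsUnique_isCodedMeasure (x : Seq 2) : ∃! μ : Measure (Seq 2), IsCodedMeasure x μ := by
  suffices h : ∃ μ, IsCodedMeasure x μ by
    obtain ⟨μ, hμ⟩ := h
    exact ⟨μ, hμ, fun ν hν => isCodedMeasure_unique hν hμ⟩
  let ν : List (Fin 2) → Measure (Fin 2) := fun σ =>
    ENNReal.ofReal (columnReal x (idx σ)) • Measure.dirac 0 +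
      ENNReal.ofReal (1 - columnReal x (idx σ)) • Measure.dirac 1
  have hν : ∀ σ, IsProbabilityMeasure (ν σ) := fun σ => ⟨by
    have := columnReal_mem x (idx σ)
    simp only [ν, Measure.coe_add, Measure.coe_smul, Pi.add_apply, Pi.smul_apply, measure_univ,
      smul_eq_mul, mul_one]
    rw [← ENNReal.ofReal_add this.1 (by linarith [this.2])]
    simp⟩
  have hν0 : ∀ σ, ν σ {0} = ENNReal.ofReal (columnReal x (idx σ)) := fun σ => by simp [ν]
  have hval : ∀ σ, (Measure.infinitePi ν).map (fun ω k => ω (node ω k)) (cyl σ) =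
      ∏ τ ∈ properPrefixes σ, ν τ {σ.getD τ.length 0} := by
    intro σ
    rw [Measure.map_apply measurable_path (measurableSet_cyl σ),
      ← Measure.infinitePi_pi (μ := ν) (fun τ _ => measurableSet_singleton _)]
    congr 1
    ext ω
    exact path_mem_cyl ω σ
  refine ⟨(Measure.infinitePi ν).map (fun ω k => ω (node ω k)), ?_, fun σ => ?_⟩
  · rw [hval]; simp [properPrefixes]
  · rw [hval, hval, properPrefixes_append, Finset.prod_insert fun h =>
      (length_of_mem_properPrefixes h).false]
    congr 1
    · rw [← hν0]; simp
    · exact Finset.prod_congr rfl fun τ hτ => by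
        rw [List.getD_append _ _ _ _ (length_of_mem_properPrefixes hτ)]

end AlgRandom

/-! The two kinds of measure concentrate differently on long strings. If `x` is random, every long
`σ` has induced mass at most (16/25)^|σ|. A random measure is more lopsided: stepping to the heavier
child each time leads, for arbitrarily large k, to a string of length k with mass above (16/25)^k.

Induced measure: `hitCount x L 0 σ / 2 ^ L` is the proportion of paths of length L that have
produced `σ`; it is nondecreasing in L, and its supremum bounds the mass of `σ`
(`inducedMeasure_cyl_le`). Labels in the two subtrees of a node are independent, so the moments obey
a recursion, and the third is at most 15 · 2^(-3|σ|) (`lintegral_hitCount_le`). Markov's inequality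
and a union bound over the 2^k strings of length k give 15 · (2(25/32)³)^k, which is summable, so
large values form a Martin-Löf test (`IsMLRandom.hitCount_lt`).

Random measure: three digits of a column already show that the heavier child receives a fraction at
least w/8, with w uniform on {4, 5, 6, 7}. The heavy path never reuses a column, so the weights are
independent, and Markov's inequality for the inverse of their product makes the product exceed
(128/25)^k at arbitrarily large levels (`IsMLRandom.exists_lt_heavyProd`). The mass is at least this
product divided by 8^k (`IsCodedMeasure.exists_heavyProd_mul_le`).

The rate 16/25 = 0.64 lies between 2^(-2/3) ≈ 0.630, the limit of the third moment method, and
210/319 ≈ 0.658, the limit of the three-digit estimate. Second moments would only reach 2^(-1/2) ≈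
0.707. -/

namespace AlgRandom

/-! ### Independence of functions of disjoint sets of coordinates -/

/-- A measurable function of the coordinates in `S` is measurable with respect to the σ-algebra
generated by these coordinates. -/
theorem measurable_iSup_comap_of_dependsOn {n : ℕ} [NeZero n] {S : Set ℕ} {f : Seq n → ℝ≥0∞}
    (hf : Measurable f) (hS : DependsOn f S) :
    Measurable[⨆ i ∈ S, MeasurableSpace.comap (fun x : Seq n => x i) inferInstance] f := by
  classical
  -- Resetting the coordinates outside `S` to 0 does not change `f`, and the resetting map is
  -- measurable for the smaller σ-algebra.
  have h : f = f ∘ fun x i => if i ∈ S then x i else 0 := by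
    ext x
    exact hS fun i hi => by simp [hi]
  rw [h]
  refine hf.comp ?_
  refine @measurable_pi_lambda _ _ _ (_) _ _ fun i => ?_
  by_cases hi : i ∈ S
  · simp only [hi, if_true]
    exact Measurable.of_comap_le (le_iSup₂_of_le i hi le_rfl)
  · simp only [hi, if_false]
    exact measurable_const

/-- Functions of disjoint sets of coordinates are independent. -/
theorem lintegral_mul_of_dependsOn {n : ℕ} [NeZero n] {S T : Set ℕ} (hST : Disjoint S T)
    {f g : Seq n → ℝ≥0∞} (hf : Measurable f) (hg : Measurable g) (hS : DependsOn f S)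
    (hT : DependsOn g T) :
    ∫⁻ x, f x * g x ∂lebesgue n = (∫⁻ x, f x ∂lebesgue n) * ∫⁻ x, g x ∂lebesgue n := by
  have hle : ∀ i, MeasurableSpace.comap (fun x : Seq n => x i) inferInstance ≤
      (inferInstance : MeasurableSpace (Seq n)) := fun i => (measurable_pi_apply i).comap_le
  have hi : ProbabilityTheory.iIndepFun (fun (i : ℕ) (x : Seq n) => x i) (lebesgue n) :=
    ProbabilityTheory.iIndepFun_infinitePi (X := fun _ ω => ω) (by fun_prop)
  refine ProbabilityTheory.lintegral_mul_eq_lintegral_mul_lintegral_of_independent_measurableSpace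
    (iSup₂_le fun i _ => hle i) (iSup₂_le fun i _ => hle i)
    (ProbabilityTheory.indep_iSup_of_disjoint hle hi hST)
    (measurable_iSup_comap_of_dependsOn hf hS) (measurable_iSup_comap_of_dependsOn hg hT)

instance (n : ℕ) [NeZero n] : IsProbabilityMeasure (lebesgue n) := by
  unfold lebesgue; infer_instance

theorem lebesgue_eval {n : ℕ} [NeZero n] (i : ℕ) (b : Fin n) :
    lebesgue n {x | x i = b} = (n : ℝ≥0∞)⁻¹ := by
  have : {x : Seq n | x i = b} = Set.pi ({i} : Finset ℕ) fun _ => {b} := by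
    ext x; simp
  rw [this, lebesgue, Measure.infinitePi_pi _ (fun i _ => measurableSet_singleton _)]
  simp

/-- Averaging over one coordinate. -/
theorem lintegral_eval {n : ℕ} [NeZero n] (i : ℕ) (G : Fin n → Seq n → ℝ≥0∞)
    (hG : ∀ b, Measurable (G b)) {S : Set ℕ} (hS : ∀ b, DependsOn (G b) S) (hi : i ∉ S) :
    ∫⁻ x, G (x i) x ∂lebesgue n = (n : ℝ≥0∞)⁻¹ * ∑ b, ∫⁻ x, G b x ∂lebesgue n := by
  have hm : ∀ b, MeasurableSet {x : Seq n | x i = b} := fun b =>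
    (measurable_pi_apply i : Measurable fun x : Seq n => x i) (measurableSet_singleton b)
  have h : ∀ x, G (x i) x = ∑ b, {x : Seq n | x i = b}.indicator 1 x * G b x := fun x => by
    rw [Finset.sum_eq_single (x i)]
    · simp
    · intro b _ hb
      simp [indicator, hb.symm]
    · simp
  simp_rw [h]
  rw [lintegral_finsetSum (f := fun b x => {x : Seq n | x i = b}.indicator 1 x * G b x) _
    fun b _ => (measurable_one.indicator (hm b)).mul (hG b), Finset.mul_sum]
  refine Finset.sum_congr rfl fun b _ => ?_
  rw [lintegral_mul_of_dependsOn (S := {i}) (T := S) (by simpa using hi)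
    (measurable_one.indicator (hm b)) (hG b) ?_ (hS b), lintegral_indicator_one (hm b),
    lebesgue_eval]
  intro x y hxy
  have : x i = y i := hxy i rfl
  simp [indicator, this]

/-! ### Recursively enumerable predicates and tests -/

theorem rePred_exists_of_primrecPred {α β : Type*} [Primcodable α] [Primcodable β]
    {R : α × β → Prop} (hR : PrimrecPred R) : REPred fun a => ∃ b, R (a, b) := by
  classical
  -- Unbounded search through the codes of possible witnesses.
  let f : α → ℕ → Option Unit := fun a n =>
    (Encodable.decode (α := β) n).bind fun b => if R (a, b) then some () else none
  have hf : Primrec₂ f := by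
    refine Primrec.option_bind (Primrec.decode.comp Primrec.snd) ?_
    refine Primrec.ite (hR.comp ?_) (Primrec.const _) (Primrec.const _)
    exact Primrec.pair (Primrec.fst.comp Primrec.fst) Primrec.snd
  have := (Partrec.rfindOpt (f := f) hf.to_comp).dom_re
  refine this.of_eq fun a => ?_
  rw [Nat.rfindOpt_dom]
  constructor
  · rintro ⟨n, u, h⟩
    obtain ⟨b, -, hb⟩ := Option.mem_bind_iff.1 h
    by_cases hR : R (a, b)
    · exact ⟨b, hR⟩
    · simp [hR] at hb
  · rintro ⟨b, hb⟩
    exact ⟨Encodable.encode b, (), by simp [f, hb]⟩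

/-- The sequence of class `U i = {x | ∃ b, P (i, b) x}` is uniformly `Σ⁰₁` if `P (i, b)` is a
primitive recursive condition on the first `B (i, b)` digits. -/
theorem exists_rePred_cyl {n : ℕ} [NeZero n] {β : Type*} [Primcodable β]
    {P : ℕ × β → Seq n → Prop} {B : ℕ × β → ℕ} (hB : Primrec B)
    (hP : PrimrecPred fun q : (ℕ × β) × List (Fin n) => P q.1 fun j => q.2.getD j 0)
    (hdep : ∀ a, DependsOn (P a) (Iio (B a))) :
    ∃ W : ℕ × List (Fin n) → Prop, REPred W ∧
      ∀ i, {x | ∃ b, P (i, b) x} = {x | ∃ σ, W (i, σ) ∧ x ∈ cyl σ} := by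
  -- Only strings long enough to decide `P` are admitted, so the padding value 0 has no influence.
  refine ⟨fun q => ∃ b, B (q.1, b) ≤ q.2.length ∧ P (q.1, b) fun j => q.2.getD j 0, ?_, ?_⟩
  · have hg : Primrec fun q : (ℕ × List (Fin n)) × β => (q.1.1, q.2) :=
      (Primrec.fst.comp Primrec.fst).pair Primrec.snd
    refine rePred_exists_of_primrecPred (R := fun q : (ℕ × List (Fin n)) × β =>
      B (q.1.1, q.2) ≤ q.1.2.length ∧ P (q.1.1, q.2) fun j => q.1.2.getD j 0) (.and ?_ ?_)
    · exact Primrec.nat_le.comp (hB.comp hg)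
        (Primrec.list_length.comp (Primrec.snd.comp Primrec.fst))
    · exact hP.comp (hg.pair (Primrec.snd.comp Primrec.fst))
  · intro i
    have key : ∀ (x : Seq n) (b : β) (σ : List (Fin n)), B (i, b) ≤ σ.length → x ∈ cyl σ →
        (P (i, b) x ↔ P (i, b) fun j => σ.getD j 0) := by
      intro x b σ h hx
      refine iff_of_eq (hdep (i, b) fun j hj => ?_)
      have hj' : j < σ.length := (mem_Iio.1 hj).trans_le h
      rw [List.getD_eq_getElem _ _ hj']
      exact hx ⟨j, hj'⟩
    ext x
    constructor
    · rintro ⟨b, hb⟩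
      have hl : B (i, b) ≤ (restr x (B (i, b))).length := by simp [restr]
      exact ⟨restr x (B (i, b)), ⟨b, hl, (key x b _ hl (mem_cyl_restr _ _)).1 hb⟩,
        mem_cyl_restr _ _⟩
    · rintro ⟨σ, ⟨b, hl, hb⟩, hx⟩
      exact ⟨b, (key x b _ hl hx).2 hb⟩

theorem primrec₂_pow : Primrec₂ ((· ^ ·) : ℕ → ℕ → ℕ) :=
  Primrec₂.unpaired'.1 Nat.Primrec.pow

/-! ### Descendants of a node of the binary tree -/

/-- The positions of the descendants of the string at position `n`, which is itself included. -/
def desc (n : ℕ) : Set ℕ :=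
  {m | ∃ τ : List (Fin 2), τ.foldl (fun k (b : Fin 2) => 2 * k + (b : ℕ) + 1) n = m}

theorem foldl_idx (ρ τ : List (Fin 2)) :
    τ.foldl (fun k (b : Fin 2) => 2 * k + (b : ℕ) + 1) (idx ρ) = idx (ρ ++ τ) := by
  induction τ generalizing ρ with
  | nil => simp
  | cons b τ ih => rw [List.foldl_cons, ← idx_append, ih]; simp

theorem self_mem_desc (n : ℕ) : n ∈ desc n := ⟨[], rfl⟩

theorem desc_child_subset (n : ℕ) (c : Fin 2) : desc (2 * n + c + 1) ⊆ desc n := by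
  rintro m ⟨τ, rfl⟩
  exact ⟨c :: τ, rfl⟩

/-- These are the positions of the extensions of ρ0 and of ρ1, and `idx` is injective. -/
theorem disjoint_desc_child (n : ℕ) :
    Disjoint (desc (2 * n + (0 : Fin 2) + 1)) (desc (2 * n + (1 : Fin 2) + 1)) := by
  rw [Set.disjoint_left]
  rintro m ⟨τ, hτ⟩ ⟨τ', hτ'⟩
  obtain ⟨ρ, rfl⟩ := idx_bijective.2 n
  have h : idx (ρ ++ 0 :: τ) = idx (ρ ++ 1 :: τ') := by
    rw [← foldl_idx, ← foldl_idx]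
    exact hτ.trans hτ'.symm
  simpa using idx_bijective.1 h

/-! ### Counting the paths whose output extends a given string -/

/-- What is left of the requested output `σ` after the label `a`; `none` if `a` is not the
requested digit. -/
def advance (a : Fin 3) (σ : List (Fin 2)) : Option (List (Fin 2)) :=
  match σ with
  | [] => some []
  | b :: τ => if a = 2 then some (b :: τ) else if a = b.castSucc then some τ else none

/-- The number of paths of length `L` from the node at position `n` whose output (the labels
met, without the `2`'s) extends `σ`. -/
def hitCount (x : Seq 3) : ℕ → ℕ → List (Fin 2) → ℕ
  | 0, _, σ => if σ = [] then 1 else 0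
  | L + 1, n, σ => ∑ c : Fin 2,
      (advance (x (2 * n + c)) σ).elim 0 (hitCount x L (2 * n + c + 1))

/-- The paths counted by `hitCount` whose first step leads to the child `c`, with
first label `a`. -/
def branchCount (x : Seq 3) (L n : ℕ) (σ : List (Fin 2)) (c : Fin 2) (a : Fin 3) : ℕ :=
  (advance a σ).elim 0 (hitCount x L (2 * n + c + 1))

theorem hitCount_succ (x : Seq 3) (L n : ℕ) (σ : List (Fin 2)) :
    hitCount x (L + 1) n σ = branchCount x L n σ 0 (x (2 * n + (0 : Fin 2))) +
      branchCount x L n σ 1 (x (2 * n + (1 : Fin 2))) := by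
  rw [hitCount, Fin.sum_univ_two]; rfl

theorem hitCount_nil (x : Seq 3) (L n : ℕ) : hitCount x L n [] = 2 ^ L := by
  induction L generalizing n with
  | zero => rfl
  | succ L ih => simp [hitCount, advance, ih, pow_succ, mul_comm]

/-- A path that has produced `σ` keeps it in both of its continuations. Hence the proportion of
successful paths is nondecreasing in `L`. -/
theorem two_mul_hitCount_le (x : Seq 3) (L n : ℕ) (σ : List (Fin 2)) :
    2 * hitCount x L n σ ≤ hitCount x (L + 1) n σ := by
  induction L generalizing n σ with
  | zero =>
    by_cases h : σ = []
    · subst h; simp [hitCount_nil]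
    · simp [hitCount, h]
  | succ L ih =>
    rw [hitCount, hitCount, Finset.mul_sum]
    refine Finset.sum_le_sum fun c _ => ?_
    cases advance (x (2 * n + c)) σ with
    | none => simp
    | some τ => exact ih _ _

/-- Coordinate `i` is the label of the node at position `i + 1`, and only labels of proper
descendants are read. -/
theorem dependsOn_hitCount (L n : ℕ) (σ : List (Fin 2)) :
    DependsOn (fun x => hitCount x L n σ) {i | i + 1 ∈ desc n ∧ n < i + 1} := by
  induction L generalizing n σ with
  | zero => exact fun _ _ _ => rfl
  | succ L ih =>
    intro x y h
    simp only [hitCount]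
    refine Finset.sum_congr rfl fun c _ => ?_
    rw [h (2 * n + c) ⟨desc_child_subset n c (self_mem_desc _), by omega⟩]
    cases advance (y (2 * n + c)) σ with
    | none => rfl
    | some τ => exact ih _ τ fun i hi => h i ⟨desc_child_subset n c hi.1, by have := hi.2; omega⟩

/-- A step to a child at most doubles position plus 2. A computable bound on the digits read is
needed for the test. -/
theorem dependsOn_hitCount_Iio (L n : ℕ) (σ : List (Fin 2)) :
    DependsOn (fun x => hitCount x L n σ) (Iio (2 ^ L * (n + 2))) := by
  induction L generalizing n σ with
  | zero => exact fun _ _ _ => rfl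
  | succ L ih =>
    intro x y h
    simp only [hitCount]
    refine Finset.sum_congr rfl fun c _ => ?_
    have hp : 1 ≤ 2 ^ L := Nat.one_le_two_pow
    have hc := c.2
    rw [h (2 * n + c) (by simp only [mem_Iio, pow_succ]; nlinarith)]
    cases advance (y (2 * n + c)) σ with
    | none => rfl
    | some τ =>
      refine ih _ τ fun i hi => h i ?_
      simp only [mem_Iio, pow_succ] at hi ⊢
      nlinarith

theorem dependsOn_branchCount (L n : ℕ) (σ : List (Fin 2)) (c : Fin 2) (a : Fin 3) :
    DependsOn (fun x => branchCount x L n σ c a)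
      {i | i + 1 ∈ desc (2 * n + c + 1) ∧ 2 * n + c + 1 < i + 1} := by
  intro x y h
  simp only [branchCount]
  cases advance a σ with
  | none => rfl
  | some τ => exact dependsOn_hitCount _ _ _ h

theorem measurable_eval_comp {n : ℕ} {β : Type*} [MeasurableSpace β] (i : ℕ)
    {G : Fin n → Seq n → β} (hG : ∀ a, Measurable (G a)) : Measurable fun x => G (x i) x :=
  (measurable_from_prod_countable_right (f := fun p : Fin n × Seq n => G p.1 p.2) hG).comp
    (f := fun x : Seq n => (x i, x)) ((measurable_pi_apply i).prodMk measurable_id)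

theorem measurable_hitCount (L n : ℕ) (σ : List (Fin 2)) :
    Measurable fun x => hitCount x L n σ := by
  induction L generalizing n σ with
  | zero => exact measurable_const
  | succ L ih =>
    refine Finset.measurable_sum _ fun c _ => measurable_eval_comp (2 * n + c)
      (G := fun a x => (advance a σ).elim 0 (hitCount x L (2 * n + c + 1))) fun a => ?_
    cases advance a σ with
    | none => exact measurable_const
    | some τ => exact ih _ _

theorem measurable_branchCount (L n : ℕ) (σ : List (Fin 2)) (c : Fin 2) (a : Fin 3) :
    Measurable fun x => branchCount x L n σ c a := by
  simp only [branchCount]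
  cases advance a σ with
  | none => exact measurable_const
  | some τ => exact measurable_hitCount _ _ _

/-! ### The first three moments -/

/-- Of the three equally likely first labels, 2 leaves the request unchanged, one removes its first
digit, and one kills the branch; the last contributes nothing because `p ≠ 0`. -/
theorem lintegral_branchCount_pow (L n : ℕ) (b : Fin 2) (τ : List (Fin 2)) (c : Fin 2) {p : ℕ}
    (hp : p ≠ 0) :
    ∫⁻ x, (branchCount x L n (b :: τ) c (x (2 * n + c)) : ℝ≥0∞) ^ p ∂lebesgue 3 =
      3⁻¹ * (∫⁻ x, (hitCount x L (2 * n + c + 1) (b :: τ) : ℝ≥0∞) ^ p ∂lebesgue 3 +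
        ∫⁻ x, (hitCount x L (2 * n + c + 1) τ : ℝ≥0∞) ^ p ∂lebesgue 3) := by
  have h := lintegral_eval (n := 3) (2 * n + c)
    (fun a x => (branchCount x L n (b :: τ) c a : ℝ≥0∞) ^ p)
    (fun a => (Measurable.of_discrete (f := fun k : ℕ => (k : ℝ≥0∞) ^ p)).comp
      (measurable_branchCount L n (b :: τ) c a))
    (S := {i | i + 1 ∈ desc (2 * n + c + 1) ∧ 2 * n + c + 1 < i + 1})
    (fun a x y hxy => by
      have := dependsOn_branchCount L n (b :: τ) c a hxy
      simp only at this
      simp only [this])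
    (fun h => absurd h.2 (lt_irrefl _))
  rw [h, Fin.sum_univ_three]
  fin_cases b <;> simp [branchCount, advance, hp, add_comm]

theorem dependsOn_branchCount_eval (L n : ℕ) (σ : List (Fin 2)) (c : Fin 2) :
    DependsOn (fun x => branchCount x L n σ c (x (2 * n + c)))
      {i | i + 1 ∈ desc (2 * n + c + 1)} := by
  intro x y h
  simp only [h (2 * n + c) (self_mem_desc _)]
  exact dependsOn_branchCount L n σ c _ fun i hi => h i hi.1

/-- Each branch reads only labels at or below its own child, so the two are independent. -/
theorem lintegral_branchCount_mul (L n : ℕ) (σ : List (Fin 2)) (p q : ℕ) :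
    ∫⁻ x, (branchCount x L n σ 0 (x (2 * n + (0 : Fin 2))) : ℝ≥0∞) ^ p *
        (branchCount x L n σ 1 (x (2 * n + (1 : Fin 2))) : ℝ≥0∞) ^ q ∂lebesgue 3 =
      (∫⁻ x, (branchCount x L n σ 0 (x (2 * n + (0 : Fin 2))) : ℝ≥0∞) ^ p ∂lebesgue 3) *
        ∫⁻ x, (branchCount x L n σ 1 (x (2 * n + (1 : Fin 2))) : ℝ≥0∞) ^ q ∂lebesgue 3 := by
  have hm : ∀ (c : Fin 2) (p : ℕ),
      Measurable fun x => (branchCount x L n σ c (x (2 * n + c)) : ℝ≥0∞) ^ p := fun c p =>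
    (Measurable.of_discrete (f := fun k : ℕ => (k : ℝ≥0∞) ^ p)).comp
      (measurable_eval_comp (2 * n + c) fun a => measurable_branchCount L n σ c a)
  have hd : ∀ (c : Fin 2) (p : ℕ),
      DependsOn (fun x => (branchCount x L n σ c (x (2 * n + c)) : ℝ≥0∞) ^ p)
        {i | i + 1 ∈ desc (2 * n + c + 1)} := fun c p x y hxy => by
    have := dependsOn_branchCount_eval L n σ c hxy
    simp only at this
    simp only [this]
  refine lintegral_mul_of_dependsOn ?_ (hm 0 p) (hm 1 q) (hd 0 p) (hd 1 q)
  exact Set.disjoint_left.2 fun i h0 h1 => Set.disjoint_left.1 (disjoint_desc_child n) h0 h1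

theorem lintegral_branchCount_mono {f g : Seq 3 → ℝ≥0∞} {u v w : ℝ≥0∞} (A : ℝ≥0∞)
    (hf : ∫⁻ x, f x ∂lebesgue 3 ≤ u * A) (hg : ∫⁻ x, g x ∂lebesgue 3 ≤ v * A)
    (h : u + v = 3 * w) :
    3⁻¹ * (∫⁻ x, f x ∂lebesgue 3 + ∫⁻ x, g x ∂lebesgue 3) ≤ w * A :=
  calc _ ≤ 3⁻¹ * (u * A + v * A) := by gcongr
    _ = (3⁻¹ * 3) * (w * A) := by rw [← add_mul, h]; ring
    _ = w * A := by rw [ENNReal.inv_mul_cancel (by simp) (by simp), one_mul]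

theorem lintegral_add_pow_le {f g : Seq 3 → ℝ≥0∞} (hf : Measurable f) (hg : Measurable g)
    (hmul : ∀ p q : ℕ, ∫⁻ x, f x ^ p * g x ^ q ∂lebesgue 3 =
      (∫⁻ x, f x ^ p ∂lebesgue 3) * ∫⁻ x, g x ^ q ∂lebesgue 3) (A : ℝ≥0∞)
    (f1 : ∫⁻ x, f x ^ 1 ∂lebesgue 3 ≤ 1 * A) (g1 : ∫⁻ x, g x ^ 1 ∂lebesgue 3 ≤ 1 * A)
    (f2 : ∫⁻ x, f x ^ 2 ∂lebesgue 3 ≤ 5 * A ^ 2) (g2 : ∫⁻ x, g x ^ 2 ∂lebesgue 3 ≤ 5 * A ^ 2)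
    (f3 : ∫⁻ x, f x ^ 3 ∂lebesgue 3 ≤ 45 * A ^ 3) (g3 : ∫⁻ x, g x ^ 3 ∂lebesgue 3 ≤ 45 * A ^ 3) :
    ∫⁻ x, f x + g x ∂lebesgue 3 ≤ 2 * A ∧
    ∫⁻ x, (f x + g x) ^ 2 ∂lebesgue 3 ≤ 3 * (2 * A) ^ 2 ∧
    ∫⁻ x, (f x + g x) ^ 3 ∂lebesgue 3 ≤ 15 * (2 * A) ^ 3 := by
  refine ⟨?_, ?_, ?_⟩
  · rw [lintegral_add_left hf]
    simp only [pow_one, one_mul] at f1 g1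
    exact (add_le_add f1 g1).trans_eq (by ring)
  · have e : ∀ x, (f x + g x) ^ 2 = f x ^ 2 + (g x ^ 2 + 2 * (f x ^ 1 * g x ^ 1)) := fun x => by ring
    simp_rw [e]
    rw [lintegral_add_left (by fun_prop), lintegral_add_left (by fun_prop),
      lintegral_const_mul _ (by fun_prop), hmul]
    calc _ ≤ 5 * A ^ 2 + (5 * A ^ 2 + 2 * (1 * A * (1 * A))) := by gcongr
      _ = _ := by ring
  · have e : ∀ x, (f x + g x) ^ 3 =
        f x ^ 3 + (g x ^ 3 + (3 * (f x ^ 2 * g x ^ 1) + 3 * (f x ^ 1 * g x ^ 2))) := fun x => by ring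
    simp_rw [e]
    rw [lintegral_add_left (by fun_prop), lintegral_add_left (by fun_prop),
      lintegral_add_left (by fun_prop), lintegral_const_mul _ (by fun_prop),
      lintegral_const_mul _ (by fun_prop), hmul, hmul]
    calc _ ≤ 45 * A ^ 3 + (45 * A ^ 3 + (3 * (5 * A ^ 2 * (1 * A)) + 3 * (1 * A * (5 * A ^ 2)))) := by
          gcongr
      _ = _ := by ring

/-- The constants are the fixed points of the recursion. In units of `A`, a branch has moments 1,
5m₂/3 and 3m₃, since the shortened request has twice the mean. Adding two independent branches of
total mean 2 requires 10m₂/3 + 2 = 4m₂ and 6m₃ + 30 = 8m₃, so m₂ = 3 and m₃ = 15. -/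
theorem lintegral_hitCount_le (L n : ℕ) (σ : List (Fin 2)) :
    ∫⁻ x, (hitCount x L n σ : ℝ≥0∞) ∂lebesgue 3 ≤ 2 ^ L * 2⁻¹ ^ σ.length ∧
    ∫⁻ x, (hitCount x L n σ : ℝ≥0∞) ^ 2 ∂lebesgue 3 ≤ 3 * (2 ^ L * 2⁻¹ ^ σ.length) ^ 2 ∧
    ∫⁻ x, (hitCount x L n σ : ℝ≥0∞) ^ 3 ∂lebesgue 3 ≤ 15 * (2 ^ L * 2⁻¹ ^ σ.length) ^ 3 := by
  have hnil : ∀ (L n : ℕ) (p : ℕ),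
      ∫⁻ x, (hitCount x L n [] : ℝ≥0∞) ^ p ∂lebesgue 3 = (2 ^ L) ^ p := fun L n p => by
    simp [hitCount_nil]
  have two : (2 : ℝ≥0∞) * 2⁻¹ = 1 := ENNReal.mul_inv_cancel (by simp) (by simp)
  induction L generalizing n σ with
  | zero =>
    cases σ with
    | nil => simp [hitCount_nil]
    | cons b τ => simp [hitCount]
  | succ L ih =>
    cases σ with
    | nil =>
      refine ⟨?_, ?_, ?_⟩
      · simpa using (hnil (L + 1) n 1).le
      · rw [hnil]
        simpa using le_mul_of_one_le_left' (a := ((2 : ℝ≥0∞) ^ (L + 1)) ^ 2) (b := 3) (by norm_num)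
      · rw [hnil]
        simpa using le_mul_of_one_le_left' (a := ((2 : ℝ≥0∞) ^ (L + 1)) ^ 3) (b := 15) (by norm_num)
    | cons b τ =>
      set A : ℝ≥0∞ := 2 ^ L * 2⁻¹ ^ (b :: τ).length with hA
      -- The shorter request doubles the scale, whence the values 2, 12 = 3 · 2² and 120 = 15 · 2³
      -- of `v` below.
      have hA' : 2 ^ L * 2⁻¹ ^ τ.length = 2 * A := by
        rw [hA, List.length_cons, pow_succ]
        calc (2 : ℝ≥0∞) ^ L * 2⁻¹ ^ τ.length = 2 ^ L * 2⁻¹ ^ τ.length * (2 * 2⁻¹) := by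
              rw [two, mul_one]
          _ = _ := by ring
      have hA2 : (2 : ℝ≥0∞) ^ (L + 1) * 2⁻¹ ^ (b :: τ).length = 2 * A := by rw [hA]; ring
      rw [hA2]
      have hb : ∀ m, _ := fun m => ih m (b :: τ)
      have ht : ∀ m, _ := fun m => ih m τ
      rw [← hA] at hb
      simp only [hA'] at ht
      have m1 : ∀ c : Fin 2, ∫⁻ x, (branchCount x L n (b :: τ) c (x (2 * n + c)) : ℝ≥0∞) ^ 1
          ∂lebesgue 3 ≤ 1 * A := fun c => by
        rw [lintegral_branchCount_pow _ _ _ _ _ one_ne_zero]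
        refine lintegral_branchCount_mono (u := 1) (v := 2) A ?_ ?_ (by norm_num)
        · simpa using (hb _).1
        · simpa using (ht _).1
      have m2 : ∀ c : Fin 2, ∫⁻ x, (branchCount x L n (b :: τ) c (x (2 * n + c)) : ℝ≥0∞) ^ 2
          ∂lebesgue 3 ≤ 5 * A ^ 2 := fun c => by
        rw [lintegral_branchCount_pow _ _ _ _ _ two_ne_zero]
        refine lintegral_branchCount_mono (u := 3) (v := 12) (A ^ 2) (hb _).2.1 ?_ (by norm_num)
        exact (ht _).2.1.trans_eq (by ring)
      have m3 : ∀ c : Fin 2, ∫⁻ x, (branchCount x L n (b :: τ) c (x (2 * n + c)) : ℝ≥0∞) ^ 3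
          ∂lebesgue 3 ≤ 45 * A ^ 3 := fun c => by
        rw [lintegral_branchCount_pow _ _ _ _ _ three_ne_zero]
        refine lintegral_branchCount_mono (u := 15) (v := 120) (A ^ 3) (hb _).2.2 ?_ (by norm_num)
        exact (ht _).2.2.trans_eq (by ring)
      have hmul := lintegral_branchCount_mul L n (b :: τ)
      have hm : ∀ c : Fin 2,
          Measurable fun x => (branchCount x L n (b :: τ) c (x (2 * n + c)) : ℝ≥0∞) := fun c =>
        (Measurable.of_discrete (f := fun k : ℕ => (k : ℝ≥0∞))).comp
          (measurable_eval_comp (2 * n + c) fun a => measurable_branchCount L n (b :: τ) c a)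
      simp only [hitCount_succ, Nat.cast_add]
      exact lintegral_add_pow_le (hm 0) (hm 1) hmul A (m1 0) (m1 1) (m2 0) (m2 1) (m3 0) (m3 1)

/-! ### The large values of `hitCount` form a Martin-Löf test -/

/-- Markov's inequality for the third power, with threshold (16/25)^|σ|. -/
theorem lebesgue_hitCount_large_le (L : ℕ) (σ : List (Fin 2)) :
    lebesgue 3 {x | 16 ^ σ.length * 2 ^ L ≤ 25 ^ σ.length * hitCount x L 0 σ} ≤
      15 * ((25 / 32) ^ 3) ^ σ.length := by
  set k := σ.length with hk
  have two : (2 : ℝ≥0∞) * 2⁻¹ = 1 := ENNReal.mul_inv_cancel (by simp) (by simp)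
  have hsub : {x | 16 ^ k * 2 ^ L ≤ 25 ^ k * hitCount x L 0 σ} ⊆
      {x | 1 ≤ ((25 / 16) ^ k * 2⁻¹ ^ L) ^ 3 * (hitCount x L 0 σ : ℝ≥0∞) ^ 3} := by
    intro x hx
    rw [mem_ofPred_eq, ← mul_pow]
    refine one_le_pow₀ ?_
    have h : (16 : ℝ≥0∞) ^ k * 2 ^ L ≤ 25 ^ k * hitCount x L 0 σ := by exact_mod_cast hx
    have e : (16 : ℝ≥0∞) ^ k * 16⁻¹ ^ k = 1 := by
      rw [← mul_pow, ENNReal.mul_inv_cancel (by simp) (by simp), one_pow]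
    have e' : (2 : ℝ≥0∞) ^ L * 2⁻¹ ^ L = 1 := by rw [← mul_pow, two, one_pow]
    calc (1 : ℝ≥0∞) = 16 ^ k * 2 ^ L * (16⁻¹ ^ k * 2⁻¹ ^ L) := by
          rw [mul_mul_mul_comm, e, e', one_mul]
      _ ≤ 25 ^ k * hitCount x L 0 σ * (16⁻¹ ^ k * 2⁻¹ ^ L) := by gcongr
      _ = _ := by rw [div_eq_mul_inv, mul_pow]; ring
  have hm : Measurable fun x => (hitCount x L 0 σ : ℝ≥0∞) ^ 3 :=
    (Measurable.of_discrete (f := fun k : ℕ => (k : ℝ≥0∞) ^ 3)).comp (measurable_hitCount L 0 σ)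
  calc _ ≤ _ := measure_mono hsub
    _ ≤ _ := by simpa only [one_mul] using mul_meas_ge_le_lintegral (hm.const_mul _) 1
    _ = ((25 / 16) ^ k * 2⁻¹ ^ L) ^ 3 * ∫⁻ x, (hitCount x L 0 σ : ℝ≥0∞) ^ 3 ∂lebesgue 3 :=
      lintegral_const_mul _ hm
    _ ≤ ((25 / 16) ^ k * 2⁻¹ ^ L) ^ 3 * (15 * (2 ^ L * 2⁻¹ ^ k) ^ 3) := by
      gcongr; exact (lintegral_hitCount_le L 0 σ).2.2
    _ = 15 * (((25 / 16 * 2⁻¹) ^ 3) ^ k) * ((2 * 2⁻¹) ^ L) ^ 3 := by ring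
    _ = _ := by
      rw [two, one_pow, one_pow, mul_one, div_eq_mul_inv, div_eq_mul_inv, mul_assoc,
        ← ENNReal.mul_inv (by simp) (by simp)]
      norm_num

/-- The events increase with `L`, so their union costs no more than a single one. -/
theorem lebesgue_exists_hitCount_large_le (σ : List (Fin 2)) :
    lebesgue 3 {x | ∃ L, 16 ^ σ.length * 2 ^ L ≤ 25 ^ σ.length * hitCount x L 0 σ} ≤
      15 * ((25 / 32) ^ 3) ^ σ.length := by
  have hmono : Monotone fun L => {x | 16 ^ σ.length * 2 ^ L ≤ 25 ^ σ.length * hitCount x L 0 σ} := by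
    refine monotone_nat_of_le_succ fun L x hx => ?_
    have h := two_mul_hitCount_le x L 0 σ
    simp only [mem_ofPred_eq] at hx ⊢
    calc 16 ^ σ.length * 2 ^ (L + 1) = 2 * (16 ^ σ.length * 2 ^ L) := by ring
      _ ≤ 2 * (25 ^ σ.length * hitCount x L 0 σ) := by gcongr
      _ = 25 ^ σ.length * (2 * hitCount x L 0 σ) := by ring
      _ ≤ _ := by gcongr
  have : {x | ∃ L, 16 ^ σ.length * 2 ^ L ≤ 25 ^ σ.length * hitCount x L 0 σ} =
      ⋃ L, {x | 16 ^ σ.length * 2 ^ L ≤ 25 ^ σ.length * hitCount x L 0 σ} := by ext; simp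
  rw [this, hmono.measure_iUnion]
  exact iSup_le fun L => lebesgue_hitCount_large_le L σ

/-- Union bound over all strings of each length, leading to a geometric series of ratio 2(25/32)³ =
15625/16384. With squares in place of cubes the ratio would exceed 1. -/
theorem lebesgue_exists_length_ge_hitCount_large_le (i : ℕ) :
    lebesgue 3 {x | ∃ b : ℕ × List (Fin 2), 15 * (i + 9) ≤ b.2.length ∧
      16 ^ b.2.length * 2 ^ b.1 ≤ 25 ^ b.2.length * hitCount x b.1 0 b.2} ≤ 2⁻¹ ^ i := by
  -- The 15th power of the ratio is below 1/2, and 2⁻⁹ absorbs the constant 15 · 16384/759, where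
  -- 16384/759 is the sum of the series.
  set K := 15 * (i + 9) with hK
  have hq : (2 * (25 / 32) ^ 3 : ℝ≥0∞) = ((15625 / 16384 : NNReal) : ℝ≥0∞) := by
    rw [show (15625 / 16384 : NNReal) = 2 * (25 / 32) ^ 3 by norm_num]
    push_cast
    rw [ENNReal.coe_div (by norm_num)]
    rfl
  calc _ ≤ lebesgue 3 (⋃ j : ℕ, ⋃ v : Fin (K + j) → Fin 2, {x | ∃ L,
          16 ^ (List.ofFn v).length * 2 ^ L ≤
            25 ^ (List.ofFn v).length * hitCount x L 0 (List.ofFn v)}) := by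
        refine measure_mono ?_
        rintro x ⟨⟨L, σ⟩, hl, h⟩
        obtain ⟨j, hj⟩ := Nat.exists_eq_add_of_le hl
        simp only [mem_iUnion]
        refine ⟨j, fun m => σ.get (m.cast hj.symm), L, ?_⟩
        have : List.ofFn (fun m => σ.get (Fin.cast hj.symm m)) = σ := by
          refine List.ext_getElem (by simp [hj]) fun m h1 h2 => by simp
        rw [this]
        exact h
    _ ≤ ∑' j : ℕ, ∑ v : Fin (K + j) → Fin 2, 15 * ((25 / 32 : ℝ≥0∞) ^ 3) ^ (K + j) := by
        refine (measure_iUnion_le _).trans (ENNReal.tsum_le_tsum fun j => ?_)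
        refine (measure_iUnion_fintype_le _ _).trans (Finset.sum_le_sum fun v _ => ?_)
        simpa using lebesgue_exists_hitCount_large_le (List.ofFn v)
    _ = ∑' j : ℕ, 15 * (2 * (25 / 32 : ℝ≥0∞) ^ 3) ^ K * (2 * (25 / 32 : ℝ≥0∞) ^ 3) ^ j := by
        refine tsum_congr fun j => ?_
        rw [Finset.sum_const, Finset.card_univ, nsmul_eq_mul]
        simp only [Fintype.card_pi, Fintype.card_fin, Finset.prod_const, Finset.card_univ]
        push_cast
        rw [mul_assoc, ← pow_add, mul_pow]
        ring
    _ ≤ _ := by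
        rw [ENNReal.tsum_mul_left, ENNReal.tsum_geometric, hq, ← ENNReal.coe_one,
          ← ENNReal.coe_sub, ← ENNReal.coe_inv, ← ENNReal.coe_pow]
        · have h2 : (2⁻¹ : ℝ≥0∞) ^ i = ((2⁻¹ ^ i : NNReal) : ℝ≥0∞) := by
            rw [ENNReal.coe_pow, ENNReal.coe_inv (by norm_num)]; rfl
          have h15 : (15 : ℝ≥0∞) = ((15 : NNReal) : ℝ≥0∞) := rfl
          rw [h2, h15, ← ENNReal.coe_mul, ← ENNReal.coe_mul, ENNReal.coe_le_coe, hK, pow_mul]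
          have e : (1 - 15625 / 16384 : NNReal)⁻¹ = 16384 / 759 := by
            rw [show (1 - 15625 / 16384 : NNReal) = 759 / 16384 from
              tsub_eq_of_eq_add (by norm_num), inv_div]
          rw [e]
          calc (15 : NNReal) * ((15625 / 16384) ^ 15) ^ (i + 9) * (16384 / 759)
              ≤ 15 * (2⁻¹) ^ (i + 9) * (16384 / 759) := by
                gcongr
                rw [← NNReal.coe_le_coe]
                norm_num
            _ = 2⁻¹ ^ i * (15 * 2⁻¹ ^ 9 * (16384 / 759)) := by ring
            _ ≤ 2⁻¹ ^ i * 1 := by gcongr; rw [← NNReal.coe_le_coe]; norm_num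
            _ = _ := mul_one _
        · exact (tsub_pos_of_lt (by rw [div_lt_one₀] <;> norm_num)).ne'

/-! ### `hitCount` is primitive recursive -/

/-- Replace every pair of a node and a requested output by the pairs for its children. -/
def expand (x : Seq 3) (l : List (ℕ × List (Fin 2))) : List (ℕ × List (Fin 2)) :=
  l.flatMap fun p =>
    (advance (x (2 * p.1)) p.2).elim [] (fun σ => [(2 * p.1 + 1, σ)]) ++
      (advance (x (2 * p.1 + 1)) p.2).elim [] fun σ => [(2 * p.1 + 2, σ)]

theorem sum_hitCount_expand (x : Seq 3) (L : ℕ) (l : List (ℕ × List (Fin 2))) :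
    ((expand x l).map fun p => hitCount x L p.1 p.2).sum =
      (l.map fun p => hitCount x (L + 1) p.1 p.2).sum := by
  induction l with
  | nil => rfl
  | cons p l ih =>
    have : expand x (p :: l) = ((advance (x (2 * p.1)) p.2).elim [] (fun σ => [(2 * p.1 + 1, σ)]) ++
      (advance (x (2 * p.1 + 1)) p.2).elim [] fun σ => [(2 * p.1 + 2, σ)]) ++ expand x l := rfl
    rw [this, List.map_append, List.sum_append, ih, List.map_cons, List.sum_cons]
    congr 1
    rw [hitCount, Fin.sum_univ_two, List.map_append, List.sum_append]
    simp only [Fin.val_zero, Fin.val_one, add_zero]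
    congr 1
    · cases advance (x (2 * p.1)) p.2 <;> simp
    · cases advance (x (2 * p.1 + 1)) p.2 <;> simp

/-- The recursion branches and changes its arguments. Carrying the list of all pending requests
turns it into an iteration, which is visibly primitive recursive. -/
theorem hitCount_eq_length_filter (x : Seq 3) (L n : ℕ) (σ : List (Fin 2)) :
    hitCount x L n σ = (((expand x)^[L] [(n, σ)]).filter fun p => p.2 = []).length := by
  have : ∀ l : List (ℕ × List (Fin 2)), (l.map fun p => hitCount x L p.1 p.2).sum =
      (((expand x)^[L] l).filter fun p => p.2 = []).length := by
    induction L with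
    | zero =>
      intro l
      induction l with
      | nil => rfl
      | cons p l ih =>
        simp only [Function.iterate_zero, id_eq] at ih ⊢
        rw [List.map_cons, List.sum_cons, ih, List.filter_cons]
        by_cases h : p.2 = [] <;> simp [h, hitCount, add_comm]
    | succ L ih =>
      intro l
      rw [← sum_hitCount_expand, ih, Function.iterate_succ_apply]
  simpa using this [(n, σ)]

theorem primrec₂_advance : Primrec₂ advance := by
  have h : Primrec fun q : Fin 3 × List (Fin 2) =>
      (List.casesOn q.2 (some []) fun b τ => if q.1 = 2 then some (b :: τ) else
        if q.1 = b.castSucc then some τ else none : Option (List (Fin 2))) := by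
    refine Primrec.list_casesOn
      (h := fun (q : Fin 3 × List (Fin 2)) (r : Fin 2 × List (Fin 2)) =>
        if q.1 = 2 then some (r.1 :: r.2) else if q.1 = r.1.castSucc then some r.2 else none)
      Primrec.snd (Primrec.const _) ?_
    have hq : Primrec fun a : (Fin 3 × List (Fin 2)) × Fin 2 × List (Fin 2) => a.1.1 :=
      Primrec.fst.comp Primrec.fst
    have hb : Primrec fun a : (Fin 3 × List (Fin 2)) × Fin 2 × List (Fin 2) => a.2.1 :=
      Primrec.fst.comp Primrec.snd
    have ht : Primrec fun a : (Fin 3 × List (Fin 2)) × Fin 2 × List (Fin 2) => a.2.2 :=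
      Primrec.snd.comp Primrec.snd
    refine Primrec.ite (Primrec.eq.comp hq (Primrec.const _)) ?_ (Primrec.ite
      (Primrec.eq.comp hq ((Primrec.dom_finite Fin.castSucc).comp hb)) ?_ (Primrec.const _))
    · exact Primrec.option_some.comp (Primrec.list_cons.comp hb ht)
    · exact Primrec.option_some.comp ht
  refine h.of_eq fun q => ?_
  rcases q with ⟨a, _ | ⟨b, τ⟩⟩ <;> rfl

theorem primrec₂_expand :
    Primrec₂ fun (τ : List (Fin 3)) l => expand (fun j => τ.getD j 0) l := by
  refine Primrec.list_flatMap Primrec.snd ?_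
  have h2 : Primrec fun q : (List (Fin 3) × List (ℕ × List (Fin 2))) × ℕ × List (Fin 2) =>
      2 * q.2.1 := Primrec.nat_double.comp (Primrec.fst.comp Primrec.snd)
  have key : ∀ {f g : (List (Fin 3) × List (ℕ × List (Fin 2))) × ℕ × List (Fin 2) → ℕ},
      Primrec f → Primrec g → Primrec fun q : (List (Fin 3) × List (ℕ × List (Fin 2))) × ℕ ×
        List (Fin 2) => (advance (q.1.1.getD (f q) 0) q.2.2).elim [] fun σ => [(g q, σ)] := by
    intro f g hf hg
    have hadv : Primrec fun q : (List (Fin 3) × List (ℕ × List (Fin 2))) × ℕ × List (Fin 2) =>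
        advance (q.1.1.getD (f q) 0) q.2.2 :=
      primrec₂_advance.comp ((Primrec.list_getD 0).comp (Primrec.fst.comp Primrec.fst) hf)
        (Primrec.snd.comp Primrec.snd)
    have hg' : Primrec₂ fun (q : (List (Fin 3) × List (ℕ × List (Fin 2))) × ℕ × List (Fin 2))
        (σ : List (Fin 2)) => [(g q, σ)] :=
      Primrec.list_cons.comp ((hg.comp Primrec.fst).pair Primrec.snd) (Primrec.const [])
    refine (Primrec.option_casesOn hadv (Primrec.const []) hg').of_eq fun q => ?_
    cases advance (q.1.1.getD (f q) 0) q.2.2 <;> rfl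
  exact Primrec.list_append.comp (key h2 (Primrec.succ.comp h2))
    (key (Primrec.succ.comp h2) (Primrec.succ.comp (Primrec.succ.comp h2)))

theorem primrec_hitCount : Primrec fun q : (ℕ × List (Fin 2)) × List (Fin 3) =>
    hitCount (fun j => q.2.getD j 0) q.1.1 0 q.1.2 := by
  have hit : Primrec fun q : (ℕ × List (Fin 2)) × List (Fin 3) =>
      (expand fun j => q.2.getD j 0)^[q.1.1] [(0, q.1.2)] :=
    Primrec.nat_iterate (Primrec.fst.comp Primrec.fst)
      (Primrec.list_cons.comp ((Primrec.const 0).pair (Primrec.snd.comp Primrec.fst))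
        (Primrec.const []))
      (primrec₂_expand.comp (Primrec.snd.comp Primrec.fst) Primrec.snd)
  have hf : PrimrecPred fun p : ℕ × List (Fin 2) => p.2 = [] :=
    Primrec.eq.comp Primrec.snd (Primrec.const [])
  refine (Primrec.list_length.comp ((Primrec.listFilter hf).comp hit)).of_eq fun q => ?_
  rw [hitCount_eq_length_filter]

/-- For Martin-Löf random `x`, all values `hitCount x L 0 σ / 2 ^ L` are smaller than
`(16 / 25) ^ |σ|` for long `σ`. -/
theorem IsMLRandom.hitCount_lt {x : Seq 3} (hx : IsMLRandom (lebesgue 3) x) :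
    ∃ K, ∀ σ : List (Fin 2), K ≤ σ.length → ∀ L,
      25 ^ σ.length * hitCount x L 0 σ < 16 ^ σ.length * 2 ^ L := by
  let P : ℕ × (ℕ × List (Fin 2)) → Seq 3 → Prop := fun a x => 15 * (a.1 + 9) ≤ a.2.2.length ∧
    16 ^ a.2.2.length * 2 ^ a.2.1 ≤ 25 ^ a.2.2.length * hitCount x a.2.1 0 a.2.2
  have hL : Primrec fun a : ℕ × (ℕ × List (Fin 2)) => a.2.1 := Primrec.fst.comp Primrec.snd
  have hl : Primrec fun a : ℕ × (ℕ × List (Fin 2)) => a.2.2.length :=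
    Primrec.list_length.comp (Primrec.snd.comp Primrec.snd)
  have hpow : ∀ (m : ℕ) {α : Type} [Primcodable α] {f : α → ℕ}, Primrec f →
      Primrec fun a => m ^ f a := fun m _ _ _ hf => primrec₂_pow.comp (Primrec.const m) hf
  have hP : PrimrecPred fun q : (ℕ × (ℕ × List (Fin 2))) × List (Fin 3) =>
      P q.1 fun j => q.2.getD j 0 := by
    refine .and ?_ ?_
    · exact Primrec.nat_le.comp (Primrec.nat_mul.comp (Primrec.const 15)
        (Primrec.nat_add.comp (Primrec.fst.comp Primrec.fst) (Primrec.const 9)))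
        (hl.comp Primrec.fst)
    · refine Primrec.nat_le.comp
        (Primrec.nat_mul.comp (hpow 16 (hl.comp Primrec.fst)) (hpow 2 (hL.comp Primrec.fst)))
        (Primrec.nat_mul.comp (hpow 25 (hl.comp Primrec.fst)) ?_)
      exact primrec_hitCount.comp ((Primrec.snd.comp Primrec.fst).pair Primrec.snd)
  have hB : Primrec fun a : ℕ × (ℕ × List (Fin 2)) => 2 ^ a.2.1 * (0 + 2) :=
    Primrec.nat_mul.comp (hpow 2 hL) (Primrec.const 2)
  have hdep : ∀ a, DependsOn (P a) (Iio (2 ^ a.2.1 * (0 + 2))) := fun a x y h => by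
    have := dependsOn_hitCount_Iio a.2.1 0 a.2.2 h
    simp only at this
    simp only [P, this]
  have htest : IsMLTest (lebesgue 3) fun i => {x | ∃ b, P (i, b) x} :=
    ⟨exists_rePred_cyl hB hP hdep, lebesgue_exists_length_ge_hitCount_large_le⟩
  have h := hx _ htest
  simp only [mem_iInter, mem_ofPred_eq, not_forall, not_exists] at h
  obtain ⟨i, hi⟩ := h
  -- Component `i` of the test inspects exactly the strings of at least this length, so avoiding it
  -- gives the bound for all of them.
  exact ⟨15 * (i + 9), fun σ hσ L => not_le.1 fun hle => hi (L, σ) ⟨hσ, hle⟩⟩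

/-! ### The induced measure is bounded by the values of `hitCount` -/

/-- The first `L` labels of `s` from position `j` on provide the output `σ`. -/
def Hits (s : Seq 3) : ℕ → ℕ → List (Fin 2) → Prop
  | 0, _, σ => σ = []
  | L + 1, j, σ => ∃ τ, advance (s j) σ = some τ ∧ Hits s L (j + 1) τ

theorem Hits.succ {s : Seq 3} {L j : ℕ} {σ : List (Fin 2)} (h : Hits s L j σ) :
    Hits s (L + 1) j σ := by
  induction L generalizing j σ with
  | zero =>
    have h' : σ = [] := h
    subst h'
    exact ⟨[], rfl, rfl⟩
  | succ L ih =>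
    obtain ⟨τ, h1, h2⟩ := h
    exact ⟨τ, h1, ih h2⟩

/-- The number of labels other than 2 before `j` tells which output digit comes next. Induction on
`σ`, and inside it on the distance `d` from `j` to the next such label. -/
theorem exists_hits {s : Seq 3} (hs : {k | s k ≠ 2}.Infinite) (σ : List (Fin 2)) (j : ℕ)
    (h : ∀ i : Fin σ.length,
      (removeTwos s).get hs (Nat.count (fun k => s k ≠ 2) j + i) = σ.get i) :
    ∃ L, Hits s L j σ := by
  induction σ generalizing j with
  | nil => exact ⟨0, rfl⟩
  | cons b σ ih =>
    obtain ⟨d, hd⟩ := Nat.exists_eq_add_of_le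
      (Nat.le_nth_count hs j : j ≤ Nat.nth _ (Nat.count (fun k => s k ≠ 2) j))
    induction d generalizing j with
    | zero =>
      have hj : s j ≠ 2 := by
        have := Nat.nth_mem_of_infinite hs (Nat.count (fun k => s k ≠ 2) j)
        rwa [hd] at this
      have h0 : (if s j = 1 then (1 : Fin 2) else 0) = b := by
        have := h ⟨0, by simp⟩
        simp only [removeTwos, add_zero, hd] at this
        exact this
      obtain ⟨L, hL⟩ := ih (j + 1) fun i => by
        have := h i.succ
        rw [Nat.count_succ, if_pos hj]
        simpa [add_assoc, add_comm 1] using this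
      refine ⟨L + 1, σ, ?_, hL⟩
      have hb : s j = b.castSucc := by
        rw [← h0]
        generalize s j = c at hj
        decide +revert
      rw [advance, if_neg hj, if_pos hb]
    | succ d ihd =>
      have hj : s j = 2 := by
        by_contra hj
        have := Nat.nth_count (p := fun k => s k ≠ 2) hj
        omega
      have hc : Nat.count (fun k => s k ≠ 2) (j + 1) = Nat.count (fun k => s k ≠ 2) j := by
        rw [Nat.count_succ, if_neg (by simpa using hj), add_zero]
      obtain ⟨L, hL⟩ := ihd (j + 1) (by rw [hc]; exact h) (by rw [hc]; omega)
      exact ⟨L + 1, b :: σ, by simp [advance, hj], hL⟩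

theorem restr_of_mem_cyl {n : ℕ} {y : Seq n} {σ : List (Fin n)} (h : y ∈ cyl σ) :
    restr y σ.length = σ := by
  refine List.ext_getElem (by simp [restr]) fun i h1 h2 => ?_
  simpa [restr] using h ⟨i, h2⟩

/-- Each successful path below `ρ` stands for one cylinder of length `L + ρ.length`. -/
theorem lebesgue_hits_le (x : Seq 3) (L : ℕ) (ρ σ : List (Fin 2)) :
    lebesgue 2 {y | y ∈ cyl ρ ∧ Hits (labelsAlong x y) L ρ.length σ} ≤
      hitCount x L (idx ρ) σ * 2⁻¹ ^ (L + ρ.length) := by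
  induction L generalizing ρ σ with
  | zero =>
    by_cases h : σ = []
    · refine (measure_mono fun y hy => hy.1).trans ?_
      simp [lebesgue_cyl, hitCount, h]
    · have : {y | y ∈ cyl ρ ∧ Hits (labelsAlong x y) 0 ρ.length σ} = ∅ := by
        ext y; simp [Hits, h]
      simp [this]
  | succ L ih =>
    have hsub : {y | y ∈ cyl ρ ∧ Hits (labelsAlong x y) (L + 1) ρ.length σ} ⊆
        ⋃ c : Fin 2, {y | y ∈ cyl (ρ ++ [c]) ∧
          ∃ τ, advance (x (2 * idx ρ + c)) σ = some τ ∧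
            Hits (labelsAlong x y) L (ρ ++ [c]).length τ} := by
      rintro y ⟨hy, τ, h1, h2⟩
      have hc : y ∈ cyl (ρ ++ [y ρ.length]) := by rw [cyl_append]; exact ⟨hy, rfl⟩
      -- The label read after `ρ` belongs to the child, at position `2 * idx ρ + c + 1`; the shift
      -- in `label` removes the 1.
      have hl : labelsAlong x y ρ.length = x (2 * idx ρ + y ρ.length) := by
        have h := restr_of_mem_cyl hc
        rw [List.length_append, List.length_singleton] at h
        rw [labelsAlong, h, label, idx_append, Nat.add_sub_cancel]
      rw [hl] at h1
      exact mem_iUnion.2 ⟨y ρ.length, hc, τ, h1, by simpa using h2⟩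
    refine (measure_mono hsub).trans ((measure_iUnion_fintype_le _ _).trans ?_)
    rw [hitCount, Nat.cast_sum, Finset.sum_mul]
    refine Finset.sum_le_sum fun c _ => ?_
    cases hadv : advance (x (2 * idx ρ + c)) σ with
    | none => simp
    | some τ =>
      have := ih (ρ ++ [c]) τ
      simp only [Option.some.injEq, Option.elim_some, exists_eq_left']
      rw [idx_append, List.length_append, List.length_singleton] at this
      rw [List.length_append, List.length_singleton]
      rwa [show L + 1 + ρ.length = L + (ρ.length + 1) by omega]

/-- A point mapped into the cylinder has produced `σ` after finitely many labels, so the preimage is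
covered by an increasing union over `L`. -/
theorem inducedMeasure_cyl_le (x : Seq 3) (σ : List (Fin 2)) {C : ℝ≥0∞}
    (h : ∀ L, (hitCount x L 0 σ : ℝ≥0∞) ≤ C * 2 ^ L) :
    inducedMeasure (codedFun x) (cyl σ) ≤ C := by
  rw [inducedMeasure_codedFun_apply x (measurableSet_cyl σ)]
  have hsub : (codedFun x).preimage (cyl σ) ⊆
      ⋃ L, {y | y ∈ cyl ([] : List (Fin 2)) ∧ Hits (labelsAlong x y) L 0 σ} := by
    rintro y ⟨z, hz, hy, rfl⟩
    obtain ⟨L, hL⟩ := exists_hits (s := labelsAlong x y) hy σ 0 fun i => by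
      rw [Nat.count_zero, zero_add]
      exact hz i
    exact mem_iUnion.2 ⟨L, by simp [cyl_nil], hL⟩
  have hmono : Monotone fun L =>
      {y | y ∈ cyl ([] : List (Fin 2)) ∧ Hits (labelsAlong x y) L 0 σ} :=
    monotone_nat_of_le_succ fun L y hy => ⟨hy.1, hy.2.succ⟩
  refine (measure_mono hsub).trans ?_
  rw [hmono.measure_iUnion]
  refine iSup_le fun L => (lebesgue_hits_le x L [] σ).trans ?_
  calc (hitCount x L 0 σ : ℝ≥0∞) * 2⁻¹ ^ L ≤ C * 2 ^ L * 2⁻¹ ^ L := by gcongr; exact h L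
    _ = C := by
      rw [mul_assoc, ← mul_pow, ENNReal.mul_inv_cancel (by simp) (by simp), one_pow, mul_one]

/-! ### The heavy path of a random measure -/

/-- If `a`, `b`, `c` are the first three binary digits of `t ∈ [0,1]`, then the larger one of
`t` and `1 - t` is at least `heavyWeight a b c / 8`. -/
def heavyWeight (a b c : Fin 2) : ℕ := if a = 1 then 4 + 2 * b + c else 7 - (2 * b + c)

/-- The product of the weights of the first `k` steps of the heavy path from the node at
position `n`. -/
def heavyProd (z : Seq 2) : ℕ → ℕ → ℕ
  | 0, _ => 1
  | k + 1, n => heavyWeight (z (Nat.pair n 0)) (z (Nat.pair n 1)) (z (Nat.pair n 2)) *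
      heavyProd z k (2 * n + (z (Nat.pair n 0)).rev + 1)

theorem heavyWeight_ne_zero (a b c : Fin 2) : heavyWeight a b c ≠ 0 := by
  decide +revert

/-- Positions grow along the path, whichever child is chosen, so every step meets a fresh column. -/
theorem dependsOn_heavyProd (k n : ℕ) :
    DependsOn (fun z => heavyProd z k n) {i | n ≤ (Nat.unpair i).1} := by
  induction k generalizing n with
  | zero => exact fun _ _ _ => rfl
  | succ k ih =>
    intro x y h
    simp only [heavyProd]
    rw [h (Nat.pair n 0) (by simp), h (Nat.pair n 1) (by simp), h (Nat.pair n 2) (by simp)]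
    congr 1
    refine ih _ fun i hi => h i ?_
    rw [mem_ofPred_eq] at hi ⊢
    omega

/-- The columns read are bounded as for `hitCount`; the square comes from the pairing function. -/
theorem dependsOn_heavyProd_Iio (k n : ℕ) :
    DependsOn (fun z => heavyProd z k n) (Iio ((2 ^ k * (n + 2) + 1) ^ 2)) := by
  induction k generalizing n with
  | zero => exact fun _ _ _ => rfl
  | succ k ih =>
    intro x y h
    have hp : 1 ≤ 2 ^ k := Nat.one_le_two_pow
    have hlt : ∀ m ≤ 2, Nat.pair n m ∈ Iio ((2 ^ (k + 1) * (n + 2) + 1) ^ 2) := fun m hm => by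
      refine mem_Iio.2 ((Nat.pair_lt_max_add_one_sq n m).trans_le (Nat.pow_le_pow_left ?_ 2))
      have : max n m ≤ n + 2 := by omega
      rw [pow_succ]
      nlinarith
    simp only [heavyProd]
    rw [h _ (hlt 0 (by omega)), h _ (hlt 1 (by omega)), h _ (hlt 2 (by omega))]
    congr 1
    refine ih _ fun i hi => h i ((mem_Iio.1 hi).trans_le (Nat.pow_le_pow_left ?_ 2))
    have := (y (Nat.pair n 0)).rev.2
    rw [pow_succ]
    nlinarith

theorem measurable_heavyProd (k n : ℕ) : Measurable fun z => heavyProd z k n := by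
  induction k generalizing n with
  | zero => exact measurable_const
  | succ k ih =>
    refine measurable_eval_comp (Nat.pair n 0) (G := fun a z =>
      heavyWeight a (z (Nat.pair n 1)) (z (Nat.pair n 2)) *
        heavyProd z k (2 * n + a.rev + 1)) fun a => ?_
    refine measurable_eval_comp (Nat.pair n 1) (G := fun b z =>
      heavyWeight a b (z (Nat.pair n 2)) * heavyProd z k (2 * n + a.rev + 1)) fun b => ?_
    exact measurable_eval_comp (Nat.pair n 2) (G := fun c z =>
      heavyWeight a b c * heavyProd z k (2 * n + a.rev + 1)) fun c => (ih _).const_mul _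

/-- The expected value of the inverse of the weight of a step. -/
noncomputable def meanInvWeight : ℝ≥0∞ :=
  2⁻¹ * ∑ a, 2⁻¹ * ∑ b, 2⁻¹ * ∑ c, (heavyWeight a b c : ℝ≥0∞)⁻¹

/-- The three digits of column `n` are averaged one at a time. Once the first fixes the direction,
the remaining product reads later columns only, and its mean does not depend on where it starts. -/
theorem lintegral_inv_heavyProd (k n : ℕ) :
    ∫⁻ z, (heavyProd z k n : ℝ≥0∞)⁻¹ ∂lebesgue 2 = meanInvWeight ^ k := by
  induction k generalizing n with
  | zero => simp [heavyProd]
  | succ k ih =>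
    have hm : ∀ (w m : ℕ), Measurable fun z => ((w * heavyProd z k m : ℕ) : ℝ≥0∞)⁻¹ := fun w m =>
      (Measurable.of_discrete (f := fun j : ℕ => ((w * j : ℕ) : ℝ≥0∞)⁻¹)).comp
        (measurable_heavyProd k m)
    have hd : ∀ (a : Fin 2) (j : ℕ),
        DependsOn (fun z => heavyProd z k (2 * n + a.rev + 1)) {i | i ≠ Nat.pair n j} :=
      fun a j => (dependsOn_heavyProd k _).mono fun i hi h => by
        rw [h] at hi
        simp at hi
        omega
    have hne : ∀ {j j' : ℕ}, j ≠ j' → Nat.pair n j ∈ {i | i ≠ Nat.pair n j'} := fun h h' =>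
      h (Nat.pair_eq_pair.1 h').2
    simp only [heavyProd]
    rw [lintegral_eval (Nat.pair n 0) (fun a z =>
      ((heavyWeight a (z (Nat.pair n 1)) (z (Nat.pair n 2)) *
        heavyProd z k (2 * n + a.rev + 1) : ℕ) : ℝ≥0∞)⁻¹) (S := {i | i ≠ Nat.pair n 0}) (fun a =>
        measurable_eval_comp (Nat.pair n 1) (G := fun b z =>
          ((heavyWeight a b (z (Nat.pair n 2)) *
            heavyProd z k (2 * n + a.rev + 1) : ℕ) : ℝ≥0∞)⁻¹) fun b =>
          measurable_eval_comp (Nat.pair n 2) (G := fun c z =>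
            ((heavyWeight a b c * heavyProd z k (2 * n + a.rev + 1) : ℕ) : ℝ≥0∞)⁻¹) fun c =>
            hm _ _)
      (fun a x y h => by
        have := hd a 0 h
        simp only at this
        simp only [this, h _ (hne one_ne_zero), h _ (hne two_ne_zero)]) (by simp)]
    rw [pow_succ', meanInvWeight, mul_assoc, Finset.sum_mul]
    congr 1
    refine Finset.sum_congr rfl fun a _ => ?_
    rw [lintegral_eval (Nat.pair n 1) (fun b z =>
      ((heavyWeight a b (z (Nat.pair n 2)) *
        heavyProd z k (2 * n + a.rev + 1) : ℕ) : ℝ≥0∞)⁻¹) (S := {i | i ≠ Nat.pair n 1}) (fun b =>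
        measurable_eval_comp (Nat.pair n 2) (G := fun c z =>
            ((heavyWeight a b c * heavyProd z k (2 * n + a.rev + 1) : ℕ) : ℝ≥0∞)⁻¹) fun c =>
            hm _ _)
      (fun b x y h => by
        have := hd a 1 h
        simp only at this
        simp only [this, h _ (hne (show 2 ≠ 1 by norm_num))]) (by simp)]
    rw [mul_assoc, Finset.sum_mul]
    congr 1
    refine Finset.sum_congr rfl fun b _ => ?_
    rw [lintegral_eval (Nat.pair n 2) (fun c z =>
      ((heavyWeight a b c * heavyProd z k (2 * n + a.rev + 1) : ℕ) : ℝ≥0∞)⁻¹)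
      (S := {i | i ≠ Nat.pair n 2}) (fun c => hm _ _)
      (fun c x y h => by
        have := hd a 2 h
        simp only at this
        simp only [this]) (by simp)]
    rw [mul_assoc, Finset.sum_mul]
    congr 1
    refine Finset.sum_congr rfl fun c _ => ?_
    have e : ∀ z, ((heavyWeight a b c * heavyProd z k (2 * n + a.rev + 1) : ℕ) : ℝ≥0∞)⁻¹ =
        (heavyWeight a b c : ℝ≥0∞)⁻¹ * (heavyProd z k (2 * n + a.rev + 1) : ℝ≥0∞)⁻¹ := fun z => by
      rw [Nat.cast_mul, ENNReal.mul_inv (.inr (by simp)) (.inl (by simp))]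
    simp_rw [e]
    rw [lintegral_const_mul' _ _ (by simp [heavyWeight_ne_zero]), ih]
    rfl

/-- The weights 4, 5, 6, 7 are equally likely, so the mean inverse is 319/1680. The base is then
about 0.972, and 25 factors suffice to get below 1/2. -/
theorem meanInvWeight_pow_le : (128 / 25 * meanInvWeight) ^ 25 ≤ 2⁻¹ := by
  have h : meanInvWeight = ((319 / 1680 : NNReal) : ℝ≥0∞) := by
    have hi : ∀ m : ℕ, m ≠ 0 → (m : ℝ≥0∞)⁻¹ = (((m : NNReal)⁻¹ : NNReal) : ℝ≥0∞) := fun m hm => by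
      rw [ENNReal.coe_inv (by exact_mod_cast hm)]; simp
    have h2 : (2 : ℝ≥0∞)⁻¹ = ((2⁻¹ : NNReal) : ℝ≥0∞) := by
      rw [ENNReal.coe_inv (by norm_num)]; rfl
    simp only [meanInvWeight, hi _ (heavyWeight_ne_zero _ _ _), h2]
    norm_cast
    rw [← NNReal.coe_inj]
    simp only [Fin.sum_univ_two, heavyWeight]
    norm_num
  have h' : (128 / 25 : ℝ≥0∞) = ((128 / 25 : NNReal) : ℝ≥0∞) := by
    rw [ENNReal.coe_div (by norm_num)]; rfl
  have h2 : (2 : ℝ≥0∞)⁻¹ = ((2⁻¹ : NNReal) : ℝ≥0∞) := by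
    rw [ENNReal.coe_inv (by norm_num)]; rfl
  rw [h, h', h2, ← ENNReal.coe_mul, ← ENNReal.coe_pow, ENNReal.coe_le_coe, ← NNReal.coe_le_coe]
  norm_num

/-- Markov's inequality for the inverse, as a small product is a large inverse. -/
theorem lebesgue_heavyProd_small_le (k : ℕ) :
    lebesgue 2 {z | 25 ^ k * heavyProd z k 0 ≤ 128 ^ k} ≤ (128 / 25 * meanInvWeight) ^ k := by
  have hsub : {z | 25 ^ k * heavyProd z k 0 ≤ 128 ^ k} ⊆
      {z | 1 ≤ (128 / 25) ^ k * (heavyProd z k 0 : ℝ≥0∞)⁻¹} := by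
    intro z hz
    have h : (25 : ℝ≥0∞) ^ k * heavyProd z k 0 ≤ 128 ^ k := by exact_mod_cast hz
    rw [mem_ofPred_eq, ← div_eq_mul_inv,
      ENNReal.le_div_iff_mul_le (.inr (by simp)) (.inl (by simp)), one_mul, div_eq_mul_inv, mul_pow]
    calc (heavyProd z k 0 : ℝ≥0∞) = 25 ^ k * heavyProd z k 0 * 25⁻¹ ^ k := by
          rw [mul_right_comm, ← mul_pow, ENNReal.mul_inv_cancel (by simp) (by simp), one_pow,
            one_mul]
      _ ≤ _ := by gcongr
  have hm : Measurable fun z => (heavyProd z k 0 : ℝ≥0∞)⁻¹ :=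
    (Measurable.of_discrete (f := fun j : ℕ => (j : ℝ≥0∞)⁻¹)).comp (measurable_heavyProd k 0)
  calc _ ≤ _ := measure_mono hsub
    _ ≤ _ := by simpa only [one_mul] using mul_meas_ge_le_lintegral (hm.const_mul _) 1
    _ = (128 / 25) ^ k * ∫⁻ z, (heavyProd z k 0 : ℝ≥0∞)⁻¹ ∂lebesgue 2 := lintegral_const_mul _ hm
    _ = _ := by rw [lintegral_inv_heavyProd, mul_pow]

theorem primrec_heavyProd : Primrec fun q : ℕ × List (Fin 2) =>
    heavyProd (fun j => q.2.getD j 0) q.1 0 := by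
  -- The path does not branch, so the state is just the current position and the product accumulated
  -- so far.
  let step : List (Fin 2) → ℕ × ℕ → ℕ × ℕ := fun τ p =>
    (2 * p.1 + (τ.getD (Nat.pair p.1 0) 0).rev + 1,
      p.2 * heavyWeight (τ.getD (Nat.pair p.1 0) 0) (τ.getD (Nat.pair p.1 1) 0)
        (τ.getD (Nat.pair p.1 2) 0))
  have hval : ∀ (τ : List (Fin 2)) (k : ℕ) (p : ℕ × ℕ),
      ((step τ)^[k] p).2 = p.2 * heavyProd (fun j => τ.getD j 0) k p.1 := by
    intro τ k
    induction k with
    | zero => simp [heavyProd]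
    | succ k ih =>
      intro p
      rw [Function.iterate_succ_apply, ih]
      simp only [step, heavyProd, mul_assoc]
  have hn : Primrec fun q : List (Fin 2) × (ℕ × ℕ) => q.2.1 := Primrec.fst.comp Primrec.snd
  have hget : ∀ m, Primrec fun q : List (Fin 2) × (ℕ × ℕ) => q.1.getD (Nat.pair q.2.1 m) 0 :=
    fun m => (Primrec.list_getD 0).comp Primrec.fst (Primrec₂.natPair.comp hn (Primrec.const m))
  have hw : Primrec fun q : Fin 2 × Fin 2 × Fin 2 => heavyWeight q.1 q.2.1 q.2.2 :=
    Primrec.dom_finite _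
  have hr : Primrec fun a : Fin 2 => (a.rev : ℕ) := Primrec.dom_finite _
  have hstep : Primrec₂ step := by
    refine Primrec.pair ?_ ?_
    · exact Primrec.succ.comp (Primrec.nat_add.comp (Primrec.nat_double.comp hn)
        (hr.comp (hget 0)))
    · exact Primrec.nat_mul.comp (Primrec.snd.comp Primrec.snd)
        (hw.comp ((hget 0).pair ((hget 1).pair (hget 2))))
  have := Primrec.snd.comp (Primrec.nat_iterate (f := fun q : ℕ × List (Fin 2) => q.1)
    (g := fun _ => (0, 1)) (h := fun q p => step q.2 p) Primrec.fst (Primrec.const _)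
    (hstep.comp (Primrec.snd.comp Primrec.fst) Primrec.snd))
  refine this.of_eq fun q => ?_
  rw [hval]
  simp

/-- For Martin-Löf random `z`, the weight product of the heavy path is large at
arbitrarily large levels. -/
theorem IsMLRandom.exists_lt_heavyProd {z : Seq 2} (hz : IsMLRandom (lebesgue 2) z) (K : ℕ) :
    ∃ k ≥ K, 128 ^ k < 25 ^ k * heavyProd z k 0 := by
  -- Every 25 levels halve the measure; the shift by `K` keeps all inspected levels at or above `K`.
  let P : ℕ × Unit → Seq 2 → Prop := fun a z =>
    25 ^ (25 * (a.1 + K)) * heavyProd z (25 * (a.1 + K)) 0 ≤ 128 ^ (25 * (a.1 + K))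
  have hk : Primrec fun a : ℕ × Unit => 25 * (a.1 + K) :=
    Primrec.nat_mul.comp (Primrec.const 25) (Primrec.nat_add.comp Primrec.fst (Primrec.const K))
  have hpow : ∀ (m : ℕ) {α : Type} [Primcodable α] {f : α → ℕ}, Primrec f →
      Primrec fun a => m ^ f a := fun m _ _ _ hf => primrec₂_pow.comp (Primrec.const m) hf
  have hP : PrimrecPred fun q : (ℕ × Unit) × List (Fin 2) => P q.1 fun j => q.2.getD j 0 := by
    have hk' : Primrec fun q : (ℕ × Unit) × List (Fin 2) => 25 * (q.1.1 + K) :=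
      hk.comp Primrec.fst
    exact Primrec.nat_le.comp (Primrec.nat_mul.comp (hpow 25 hk')
      (primrec_heavyProd.comp (hk'.pair Primrec.snd))) (hpow 128 hk')
  have hB : Primrec fun a : ℕ × Unit => (2 ^ (25 * (a.1 + K)) * (0 + 2) + 1) ^ 2 :=
    primrec₂_pow.comp (Primrec.succ.comp (Primrec.nat_mul.comp (hpow 2 hk) (Primrec.const 2)))
      (Primrec.const 2)
  have hdep : ∀ a, DependsOn (P a) (Iio ((2 ^ (25 * (a.1 + K)) * (0 + 2) + 1) ^ 2)) :=
    fun a x y h => by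
      have := dependsOn_heavyProd_Iio (25 * (a.1 + K)) 0 h
      simp only at this
      simp only [P, this]
  have htest : IsMLTest (lebesgue 2) fun i => {z | ∃ b, P (i, b) z} := by
    refine ⟨exists_rePred_cyl hB hP hdep, fun i => ?_⟩
    calc lebesgue 2 {z | ∃ b, P (i, b) z}
        ≤ lebesgue 2 {z | 25 ^ (25 * (i + K)) * heavyProd z (25 * (i + K)) 0 ≤
            128 ^ (25 * (i + K))} := measure_mono fun z ⟨_, h⟩ => h
      _ ≤ (128 / 25 * meanInvWeight) ^ (25 * (i + K)) := lebesgue_heavyProd_small_le _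
      _ ≤ 2⁻¹ ^ (i + K) := by rw [pow_mul]; gcongr; exact meanInvWeight_pow_le
      _ ≤ 2⁻¹ ^ i := pow_le_pow_right_of_le_one' (by simp) (by omega)
  have h := hz _ htest
  simp only [mem_iInter, mem_ofPred_eq, not_forall, not_exists] at h
  obtain ⟨i, hi⟩ := h
  exact ⟨25 * (i + K), by omega, not_le.1 (hi ())⟩

/-! ### Mass along the heavy path -/

/-- The digits after the third contribute between 0 and 1/8. -/
theorem columnReal_bounds (z : Seq 2) (n : ℕ) :
    (4 * (z (Nat.pair n 0) : ℕ) + 2 * (z (Nat.pair n 1) : ℕ) + (z (Nat.pair n 2) : ℕ) : ℝ) ≤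
        8 * columnReal z n ∧
      8 * columnReal z n ≤
        4 * (z (Nat.pair n 0) : ℕ) + 2 * (z (Nat.pair n 1) : ℕ) + (z (Nat.pair n 2) : ℕ) + 1 := by
  have h : columnReal z n = Real.ofDigits fun k => z (Nat.pair n k) := by
    simp only [columnReal, Real.ofDigits, Real.ofDigitsTerm, div_eq_mul_inv]
    norm_num
  have h3 := Real.ofDigits_eq_sum_add_ofDigits (fun k => z (Nat.pair n k)) 3
  have h0 := Real.ofDigits_nonneg fun i => (fun k => z (Nat.pair n k)) (i + 3)
  have h1 := Real.ofDigits_le_one fun i => (fun k => z (Nat.pair n k)) (i + 3)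
  simp only [Finset.sum_range_succ, Finset.sum_range_zero, Real.ofDigitsTerm] at h3
  rw [h, h3]
  norm_num at h0 h1 ⊢
  constructor <;> linarith

theorem IsCodedMeasure.apply_append_one {z : Seq 2} {μ : Measure (Seq 2)}
    (hμ : IsCodedMeasure z μ) (ρ : List (Fin 2)) :
    μ (cyl (ρ ++ [1])) = ENNReal.ofReal (1 - columnReal z (idx ρ)) * μ (cyl ρ) := by
  have : IsProbabilityMeasure μ := ⟨by rw [← cyl_nil]; exact hμ.1⟩
  have hd : cyl (ρ ++ [1]) = cyl ρ \ cyl (ρ ++ [0]) := by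
    ext x
    simp only [cyl_append, mem_inter_iff, mem_sdiff, mem_ofPred_eq]
    have : x ρ.length = 1 ↔ ¬ x ρ.length = 0 := by generalize x ρ.length = c; decide +revert
    tauto
  have hs : cyl (ρ ++ [0]) ⊆ cyl ρ := by rw [cyl_append]; exact inter_subset_left
  rw [hd, measure_sdiff hs (measurableSet_cyl _).nullMeasurableSet (measure_ne_top _ _), hμ.2,
    ENNReal.ofReal_sub _ (columnReal_mem z _).1, ENNReal.ofReal_one,
    ENNReal.sub_mul fun _ _ => measure_ne_top _ _, one_mul]

/-- The column gives the fraction of child 0. First digit 1 makes that fraction at least 1/2, first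
digit 0 at most 1/2, so the heavier child is the reversed digit. -/
theorem IsCodedMeasure.heavyWeight_mul_le {z : Seq 2} {μ : Measure (Seq 2)}
    (hμ : IsCodedMeasure z μ) (ρ : List (Fin 2)) :
    heavyWeight (z (Nat.pair (idx ρ) 0)) (z (Nat.pair (idx ρ) 1)) (z (Nat.pair (idx ρ) 2)) *
      μ (cyl ρ) ≤ 8 * μ (cyl (ρ ++ [(z (Nat.pair (idx ρ) 0)).rev])) := by
  obtain ⟨h1, h2⟩ := columnReal_bounds z (idx ρ)
  have key : ∀ (w : ℕ) (t : ℝ), (w : ℝ) ≤ 8 * t →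
      (w : ℝ≥0∞) * μ (cyl ρ) ≤ 8 * (ENNReal.ofReal t * μ (cyl ρ)) := fun w t h => by
    rw [← mul_assoc]
    gcongr
    rw [← ENNReal.ofReal_natCast, show (8 : ℝ≥0∞) = ENNReal.ofReal 8 by simp,
      ← ENNReal.ofReal_mul (by norm_num)]
    exact ENNReal.ofReal_le_ofReal h
  generalize z (Nat.pair (idx ρ) 0) = a at *
  generalize z (Nat.pair (idx ρ) 1) = b at *
  generalize z (Nat.pair (idx ρ) 2) = c at *
  have hb := b.2
  have hc := c.2
  have h01 : ∀ a : Fin 2, a = 0 ∨ a = 1 := by decide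
  obtain rfl | rfl := h01 a
  · rw [show (0 : Fin 2).rev = 1 from rfl, hμ.apply_append_one]
    refine key _ _ ?_
    rw [heavyWeight, if_neg (by decide), Nat.cast_sub (by omega)]
    push_cast at h2 ⊢
    simp at h2
    linarith
  · rw [show (1 : Fin 2).rev = 0 from rfl, hμ.2]
    refine key _ _ ?_
    rw [heavyWeight, if_pos rfl]
    push_cast at h1 ⊢
    simp at h1
    linarith

theorem IsCodedMeasure.exists_heavyProd_mul_le {z : Seq 2} {μ : Measure (Seq 2)}
    (hμ : IsCodedMeasure z μ) (k : ℕ) (ρ : List (Fin 2)) :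
    ∃ σ : List (Fin 2), σ.length = k ∧
      heavyProd z k (idx ρ) * μ (cyl ρ) ≤ 8 ^ k * μ (cyl (ρ ++ σ)) := by
  induction k generalizing ρ with
  | zero => exact ⟨[], rfl, by simp [heavyProd]⟩
  | succ k ih =>
    set a := z (Nat.pair (idx ρ) 0) with ha
    obtain ⟨σ, hl, hσ⟩ := ih (ρ ++ [a.rev])
    refine ⟨a.rev :: σ, by simp [hl], ?_⟩
    rw [idx_append] at hσ
    have h := hμ.heavyWeight_mul_le ρ
    rw [← ha] at h
    rw [heavyProd, ← ha, Nat.cast_mul]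
    set w := heavyWeight a (z (Nat.pair (idx ρ) 1)) (z (Nat.pair (idx ρ) 2))
    set M := heavyProd z k (2 * idx ρ + a.rev + 1)
    calc (w : ℝ≥0∞) * M * μ (cyl ρ) = M * (w * μ (cyl ρ)) := by ring
      _ ≤ M * (8 * μ (cyl (ρ ++ [a.rev]))) := by gcongr
      _ = 8 * (M * μ (cyl (ρ ++ [a.rev]))) := by ring
      _ ≤ 8 * (8 ^ k * μ (cyl (ρ ++ [a.rev] ++ σ))) := by gcongr
      _ = _ := by rw [List.append_assoc, List.singleton_append, pow_succ']; ring

end AlgRandom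

theorem mainTheorem12 (F : AlgRandom.Seq 2 →. AlgRandom.Seq 2)
    (hF : AlgRandom.IsRandomContinuousFunction F) :
    ¬ AlgRandom.IsRandomMeasure (AlgRandom.inducedMeasure F) := by
  obtain ⟨x, hx, rfl⟩ := hF
  rintro ⟨z, hz, hμ⟩
  obtain ⟨K, hK⟩ := hx.hitCount_lt
  -- A level past `K`, so that the upper bound on all masses also applies to the end of the heavy
  -- path.
  obtain ⟨k, hk, hlt⟩ := hz.exists_lt_heavyProd K
  obtain ⟨σ, hl, hσ⟩ := hμ.exists_heavyProd_mul_le k []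
  rw [hμ.1, mul_one, List.nil_append, show AlgRandom.idx [] = 0 from rfl] at hσ
  have h25 : (25 : ENNReal) ^ k * 25⁻¹ ^ k = 1 := by
    rw [← mul_pow, ENNReal.mul_inv_cancel (by simp) (by simp), one_pow]
  have hle : AlgRandom.inducedMeasure (AlgRandom.codedFun x) (AlgRandom.cyl σ) ≤
      25⁻¹ ^ k * 16 ^ k := by
    refine AlgRandom.inducedMeasure_cyl_le x σ fun L => ?_
    have h : (25 : ENNReal) ^ k * AlgRandom.hitCount x L 0 σ ≤ 16 ^ k * 2 ^ L := by
      have := (hK σ (hl ▸ hk) L).le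
      rw [hl] at this
      exact_mod_cast this
    calc (AlgRandom.hitCount x L 0 σ : ENNReal)
        = 25⁻¹ ^ k * (25 ^ k * AlgRandom.hitCount x L 0 σ) := by
          rw [← mul_assoc, mul_comm (25⁻¹ ^ k), h25, one_mul]
      _ ≤ 25⁻¹ ^ k * (16 ^ k * 2 ^ L) := by gcongr
      _ = _ := by rw [mul_assoc]
  -- The rates meet: 8 · 16/25 = 128/25, against the strict inequality `hlt`.
  have : (25 : ENNReal) ^ k * AlgRandom.heavyProd z k 0 ≤ 128 ^ k :=
    calc _ ≤ (25 : ENNReal) ^ k * (8 ^ k * (25⁻¹ ^ k * 16 ^ k)) := by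
          gcongr
          exact hσ.trans (by gcongr)
      _ = 25 ^ k * 25⁻¹ ^ k * (8 * 16) ^ k := by rw [mul_pow]; ring
      _ = 128 ^ k := by rw [h25, one_mul]; norm_num
  exact absurd hlt (not_lt.2 (by exact_mod_cast this))
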